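/- Let $q=p^f\geq 4$ be a power of a prime $p$, let $N=q^2-1$, and let $G\leq \mathsf{S}_N$ be a subgroup of the symmetric group on $N$ points. Let $\Phi$ denote the representation of $\mathsf{S}_N$ on its natural permutation module $\mathbb{C}^N$. Suppose that the following conditions hold. (a) $\Phi|_G\cong \bigoplus_{i=0}^{q-2}\Phi_i\oplus 1_G$, where the $\Phi_i$ are pairwise inequivalent irreducible complex representations of $G$, with $\deg\Phi_0=q$ and $\deg\Phi_i=q+1$ for $1\leq i\leq q-2$. (b) The group $G_0:=\Phi_0(G)$ embeds in $\mathsf{S}_{q+1}$, the symmetric group on the set of the $q+1$ lines (one-dimensional subspaces) of $\mathbb{F}_q^2$, with image the subgroup $\mathrm{PGL}_2(q)$ in its natural action on these lines, and in such a way that the representation of $G_0$ on the space of $\Phi_0$ is equivalent to the restriction to $G_0$ of the representation of $\mathsf{S}_{q+1}$ on its deleted permutation module (the vectors of $\mathbb{C}^{q+1}$ with coordinate sum $0$). (c) For every $g\in G$ there is an integer $k\geq 0$ with $\mathrm{Tr}(\Phi(g))+1=q^k$. Then $G\cong \mathrm{GL}_2(q)$, and the action of $G$ on the $N$ points is the natural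 action of $\mathrm{GL}_2(q)$ on the nonzero vectors of $\mathbb{F}_q^2$. That is, there are a group isomorphism $e:G\to\mathrm{GL}_2(q)$ and a bijection $x$ from the $N$ points onto $\mathbb{F}_q^2\smallsetminus\{0\}$ such that $x(g(a))=e(g)\,x(a)$ for all $g\in G$ and all points $a$. -/

import Mathlib

open scoped LinearAlgebra.Projectivization MatrixGroups

noncomputable section

/-- The natural permutation representation of the symmetric group of `X` on the complex
permutation module with basis `X`. -/
def permRep (X : Type*) :
    Representation ℂ (Equiv.Perm X) (MonoidAlgebra ℂ X) :=
  Representation.ofMulAction ℂ (Equiv.Perm X) X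

/-- The sum of the coefficients, as a linear functional on the permutation module. -/
def coeffSum (X : Type*) : MonoidAlgebra ℂ X →ₗ[ℂ] ℂ :=
  Finsupp.linearCombination ℂ (fun _ : X => (1 : ℂ)) ∘ₗ
    (MonoidAlgebra.coeffLinearEquiv ℂ).toLinearMap

theorem coeffSum_permRep (X : Type*) (g : Equiv.Perm X) (v : MonoidAlgebra ℂ X) :
    coeffSum X (permRep X g v) = coeffSum X v := by
  simp [coeffSum, permRep, Representation.ofMulAction_def, Finsupp.linearCombination_mapDomain,
    Function.comp_def]

/-- The deleted permutation module: the vectors of the permutation module whose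
coefficients sum to zero. -/
def deletedModule (X : Type*) : Submodule ℂ (MonoidAlgebra ℂ X) :=
  LinearMap.ker (coeffSum X)

/-- The representation of the symmetric group of `X` on its deleted permutation module. -/
def deletedPermRep (X : Type*) :
    Representation ℂ (Equiv.Perm X) (deletedModule X) :=
  (permRep X).subrepresentation (deletedModule X) (fun g v hv => by
    simp only [deletedModule, Submodule.mem_comap, LinearMap.mem_ker] at hv ⊢
    rw [coeffSum_permRep, hv])

/-- The image `ρ(G)` of a representation, as a subgroup of `GL(V)`. -/
def imageGroup {G V : Type*} [Group G] [AddCommGroup V] [Module ℂ V]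
    (ρ : Representation ℂ G V) : Subgroup (LinearMap.GeneralLinearGroup ℂ V) :=
  (MonoidHom.toHomUnits ρ).range

/-- The tautological representation on `V` of a subgroup of `GL(V)`. -/
def tautologicalRep {V : Type*} [AddCommGroup V] [Module ℂ V]
    (H : Subgroup (LinearMap.GeneralLinearGroup ℂ V)) : Representation ℂ H V :=
  (Units.coeHom (V →ₗ[ℂ] V)).comp H.subtype

/-- `PGL₂(F)` as a permutation group on the set of lines of `F²`. -/
def pglOnLines (F : Type*) [Field F] : Subgroup (Equiv.Perm (ℙ F (Fin 2 → F))) :=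
  (MulAction.toPermHom PGL(2, F) (ℙ F (Fin 2 → F))).range

/-- The image `G₀ = ρ(G)` embeds in the symmetric group on the lines of `F²`, with image the
subgroup `PGL₂(F)`, in such a way that the given (tautological) representation of `G₀` on `V` is
the restriction to `G₀` of the deleted permutation representation of that symmetric group. -/
def ImageIsPGLOnLines (F : Type*) [Field F] {G V : Type*} [Group G] [AddCommGroup V] [Module ℂ V]
    (ρ : Representation ℂ G V) : Prop :=
  ∃ ι : imageGroup ρ →* Equiv.Perm (ℙ F (Fin 2 → F)),
    Function.Injective ι ∧ ι.range = pglOnLines F ∧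
    Nonempty ((tautologicalRep (imageGroup ρ)).Equiv
      ((deletedPermRep (ℙ F (Fin 2 → F))).comp ι))

end

/-! The representation theory enters only through fixed-point counts. All `Φ i` have degree greater
than `1`, so orthogonality of characters gives the averages over `G` of fix, fix² and fix · (fixed
lines): they are `1`, `q` and `2` (`sum_card_fixed_of_decomposition`). The trace condition leaves
only `0` and `q - 1` as values of fix off the identity, so fix · (fix - (q - 1)) is supported at
`1`, and averaging it gives |G| = |GL₂(q)|. Hence the kernel K of G → PGL₂(q) has order `q - 1`, and
a count shows that it acts semiregularly on points.

The average `2`, instead of `1`, says that a point stabilizer is intransitive on lines. It contains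
a subgroup of order `q`, which fixes one line and is regular on the others, so the whole stabilizer
fixes that line. This attaches a line to each point equivariantly, and the fibres are the K-orbits;
`PlaneAction` records the outcome.

It remains to identify the extension of PGL₂(q) by K. An element of `G` is determined by its action
on lines and its effect on a single point (`eq_of_smul_eq`), so a relation between lifts of matrices
need only be tested at one well-chosen point. The crux is `torus_fixes_fibre`: a lift of diag(1, y)
or diag(x, 1) fixing one point of the appropriate fibre fixes that fibre pointwise, and therefore
centralizes K. Products of such lifts identify K with the scalars, the exchange of coordinates is
normalized by a scalar (`exists_frame`), and the relations obtained let `G` act by matrices in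
explicit coordinates. -/

/-! ### Traces, permutation characters and orthogonality. -/

theorem LinearMap.trace_directSum_lmap {ι k : Type*} [Fintype ι] [DecidableEq ι] [Field k]
    (V : ι → Type*) [∀ i, AddCommGroup (V i)] [∀ i, Module k (V i)]
    [∀ i, FiniteDimensional k (V i)] (f : ∀ i, V i →ₗ[k] V i) :
    LinearMap.trace k _ (DirectSum.lmap f) = ∑ i, LinearMap.trace k _ (f i) := by
  classical
  let b := fun i => Module.finBasis k (V i)
  have e : LinearMap.trace k (DirectSum ι V) (DirectSum.lmap f) = _ :=
    LinearMap.trace_eq_matrix_trace k (DFinsupp.basis b) _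
  rw [e, Matrix.trace, Fintype.sum_sigma]
  refine Finset.sum_congr rfl fun i _ => ?_
  rw [LinearMap.trace_eq_matrix_trace k (b i), Matrix.trace]
  refine Finset.sum_congr rfl fun j _ => ?_
  simp only [Matrix.diag_apply, LinearMap.toMatrix_apply]
  have hr : ∀ v : V i, ∀ p : (i : ι) × Fin (Module.finrank k (V i)),
      (DFinsupp.basis b).repr (DirectSum.lof k ι V i v) p =
        (b p.1).repr ((DFinsupp.single i v : Π₀ i, V i) p.1) p.2 := fun v p => rfl
  have h : DFinsupp.basis b ⟨i, j⟩ = DirectSum.lof k ι V i (b i j) := by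
    apply (DFinsupp.basis b).repr.injective
    ext ⟨i', j'⟩
    rw [Module.Basis.repr_self, hr]
    by_cases hi : i = i'
    · subst hi
      simp [Finsupp.single_apply]
    · simp [hi, DFinsupp.single_eq_of_ne (Ne.symm hi)]
  rw [h, DirectSum.lmap_lof, hr]
  simp

theorem trace_permRep (X : Type*) [Fintype X] (g : Equiv.Perm X) :
    LinearMap.trace ℂ _ (permRep X g) = Nat.card {x // g x = x} := by
  classical
  let b : Module.Basis X ℂ (MonoidAlgebra ℂ X) := .ofRepr (MonoidAlgebra.coeffLinearEquiv ℂ)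
  have hb : ∀ x, b x = MonoidAlgebra.single x 1 := fun x => rfl
  rw [LinearMap.trace_eq_matrix_trace ℂ b, Matrix.trace, Nat.card_eq_fintype_card,
    Fintype.card_subtype, Finset.card_filter]
  push_cast
  refine Finset.sum_congr rfl fun x _ => ?_
  simp [LinearMap.toMatrix_apply, hb, permRep]
  simp [b, Finsupp.single_apply]

/-- The vector with all coefficients equal to `1 / |X|`. -/
noncomputable def meanVector (X : Type*) [Fintype X] : MonoidAlgebra ℂ X :=
  ∑ x, MonoidAlgebra.single x (Fintype.card X : ℂ)⁻¹

theorem coeffSum_meanVector (X : Type*) [Fintype X] [Nonempty X] :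
    coeffSum X (meanVector X) = 1 := by
  simp [coeffSum, meanVector]

theorem permRep_meanVector (X : Type*) [Fintype X] (g : Equiv.Perm X) :
    permRep X g (meanVector X) = meanVector X := by
  simp only [meanVector, permRep, map_sum, Representation.ofMulAction_single]
  exact Fintype.sum_equiv g _ _ fun x => rfl

/-- The permutation module splits as the deleted permutation module and a trivial module. -/
noncomputable def permRepEquiv (X : Type*) [Fintype X] [Nonempty X] :
    (permRep X).Equiv ((deletedPermRep X).prod (Representation.trivial ℂ (Equiv.Perm X) ℂ)) :=
  .mk
    { toFun := fun v => (⟨v - coeffSum X v • meanVector X, by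
          simp [deletedModule, coeffSum_meanVector]⟩, coeffSum X v)
      map_add' := fun v w => by
        ext1
        · ext1
          simp only [map_add, add_smul, Prod.fst_add, Submodule.coe_add]
          abel
        · simp
      map_smul' := fun c v => by
        ext1
        · ext1
          simp [mul_smul, smul_sub]
        · simp
      invFun := fun p => (p.1 : MonoidAlgebra ℂ X) + p.2 • meanVector X
      left_inv := fun v => by simp
      right_inv := fun p => by
        have h : coeffSum X p.1 = 0 := p.1.2
        ext1
        · ext1
          simp [h, coeffSum_meanVector]
        · simp [h, coeffSum_meanVector] }
    (fun g => by
      refine LinearMap.ext fun v => ?_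
      refine Prod.ext (Subtype.ext ?_) ?_
      · have : (permRep X g v) - coeffSum X (permRep X g v) • meanVector X =
            permRep X g (v - coeffSum X v • meanVector X) := by
          rw [map_sub, map_smul, permRep_meanVector, coeffSum_permRep]
        exact this
      · exact coeffSum_permRep X g v)

theorem trace_deletedPermRep (X : Type*) [Fintype X] [Nonempty X] (g : Equiv.Perm X) :
    LinearMap.trace ℂ _ (deletedPermRep X g) + 1 = Nat.card {x // g x = x} := by
  have : FiniteDimensional ℂ (MonoidAlgebra ℂ X) :=
    (MonoidAlgebra.coeffLinearEquiv (M := X) (S := ℂ) ℂ).symm.finiteDimensional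
  have := congrFun (Representation.char_iso (permRepEquiv X)) g
  simp only [Representation.character] at this
  rw [← trace_permRep, this]
  have h := LinearMap.trace_prodMap' (deletedPermRep X g) (1 : ℂ →ₗ[ℂ] ℂ)
  rw [LinearMap.trace_one] at h
  simp at h
  exact h.symm

/-- The sum measures intertwiners from the trivial representation; a nonzero one would be onto `V`,
which the dimension forbids. -/
theorem Representation.sum_character_eq_zero {G V : Type*} [Group G] [Fintype G] [AddCommGroup V]
    [Module ℂ V] (ρ : Representation ℂ G V) [ρ.IsIrreducible]
    (h : 1 < Module.finrank ℂ V) : ∑ g, ρ.character g = 0 := by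
  have : FiniteDimensional ℂ V := .of_finrank_pos (by omega)
  have : Invertible (Nat.card G : ℂ) := invertibleOfNonzero (by simp)
  have key := card_inv_mul_sum_char_mul_char_eq_finrank (Representation.trivial ℂ G ℂ) ρ
  have hs : Subsingleton (IntertwiningMap (Representation.trivial ℂ G ℂ) ρ) := by
    refine subsingleton_of_forall_eq 0 fun f => ?_
    refine (IsIrreducible.surjective_or_eq_zero f).resolve_left fun hf => ?_
    have := LinearMap.finrank_range_le f.toLinearMap
    rw [LinearMap.range_eq_top.2 hf, finrank_top, Module.finrank_self] at this
    omega
  rw [Module.finrank_zero_of_subsingleton] at key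
  have h1 : ∀ g, (Representation.trivial ℂ G ℂ).character g = 1 := fun g => by
    have : Representation.trivial ℂ G ℂ g = 1 := by ext; simp
    simp [character, this]
  simpa [h1] using key

theorem Representation.sum_character_mul_character {G V W : Type*} [Group G] [Fintype G]
    [AddCommGroup V] [Module ℂ V] [FiniteDimensional ℂ V] [AddCommGroup W] [Module ℂ W]
    [FiniteDimensional ℂ W] (ρ : Representation ℂ G V) (σ : Representation ℂ G W)
    [ρ.IsIrreducible] [σ.IsIrreducible] [Decidable (Nonempty (σ.Equiv ρ))] :
    ∑ g, ρ.character g * σ.character g⁻¹ =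
      if Nonempty (σ.Equiv ρ) then (Nat.card G : ℂ) else 0 := by
  have : Invertible (Nat.card G : ℂ) := invertibleOfNonzero (by simp)
  have key := char_orthonormal ρ σ
  have h0 : (Nat.card G : ℂ) ≠ 0 := by simp
  rw [inv_mul_eq_iff_eq_mul₀ h0] at key
  rw [key]
  split_ifs <;> simp

/-- The fixed point counts forced by a multiplicity free permutation character, one of whose
constituents is the deleted permutation character of another action. -/
theorem sum_card_fixed_of_decomposition {G X P : Type*} [Group G] [Fintype G] [Fintype X]
    [Fintype P] [Nonempty P] {n : ℕ} (τ : G →* Equiv.Perm X) (ψ : G →* Equiv.Perm P)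
    (V : Fin n → Type*) [∀ i, AddCommGroup (V i)] [∀ i, Module ℂ (V i)]
    (Φ : ∀ i, Representation ℂ G (V i)) [∀ i, (Φ i).IsIrreducible]
    (deg : ∀ i, 1 < Module.finrank ℂ (V i))
    (decomp : Representation.Equiv ((permRep X).comp τ)
      ((Representation.directSum Φ).prod (Representation.trivial ℂ G ℂ)))
    (inequiv : ∀ i j, i ≠ j → IsEmpty ((Φ i).Equiv (Φ j)))
    (i₀ : Fin n) (first : (Φ i₀).Equiv ((deletedPermRep P).comp ψ)) :
    ∑ g, Nat.card {x // τ g x = x} = Nat.card G ∧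
    ∑ g, Nat.card {x // τ g x = x} ^ 2 = (n + 1) * Nat.card G ∧
    ∑ g, Nat.card {x // τ g x = x} * Nat.card {x // ψ g x = x} = 2 * Nat.card G := by
  classical
  have hfd : ∀ i, FiniteDimensional ℂ (V i) := fun i => .of_finrank_pos (by have := deg i; omega)
  have hX : ∀ g, (Nat.card {x // τ g x = x} : ℂ) = ∑ i, (Φ i).character g + 1 := fun g => by
    have h := congrFun (Representation.char_iso decomp) g
    simp only [Representation.character] at h
    have h2 := trace_permRep X (τ g)
    have h3 := LinearMap.trace_prodMap' (Representation.directSum Φ g) (1 : ℂ →ₗ[ℂ] ℂ)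
    have h4 := LinearMap.trace_directSum_lmap V (fun i => Φ i g)
    rw [LinearMap.trace_one] at h3
    rw [← h2]
    refine h.trans (h3.trans ?_)
    simp only [Module.finrank_self, Nat.cast_one, Representation.character, ← h4]
    rfl
  have hP : ∀ g, (Nat.card {x // ψ g x = x} : ℂ) = (Φ i₀).character g + 1 := fun g => by
    rw [← trace_deletedPermRep, Representation.char_iso first]
    rfl
  -- Orthogonality pairs a value at `g` with one at `g⁻¹`; fixed-point counts do not see the
  -- difference.
  have hinv : ∀ g, Nat.card {x // τ g⁻¹ x = x} = Nat.card {x // τ g x = x} := fun g => by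
    refine Nat.card_congr (Equiv.subtypeEquivRight fun x => ?_)
    rw [map_inv, Equiv.Perm.inv_eq_iff_eq, eq_comm]
  have hinv' : ∀ g, Nat.card {x // ψ g⁻¹ x = x} = Nat.card {x // ψ g x = x} := fun g => by
    refine Nat.card_congr (Equiv.subtypeEquivRight fun x => ?_)
    rw [map_inv, Equiv.Perm.inv_eq_iff_eq, eq_comm]
  have h0 : ∀ i, ∑ g, (Φ i).character g = 0 := fun i => (Φ i).sum_character_eq_zero (deg i)
  have h0' : ∀ i, ∑ g, (Φ i).character g⁻¹ = 0 := fun i => by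
    rw [← h0 i]
    exact Fintype.sum_equiv (Equiv.inv G) _ _ fun g => rfl
  have h1 : ∀ i j, ∑ g, (Φ i).character g * (Φ j).character g⁻¹ =
      if i = j then (Nat.card G : ℂ) else 0 := fun i j => by
    rw [Representation.sum_character_mul_character]
    by_cases hij : i = j
    · subst hij
      rw [if_pos rfl, if_pos ⟨.refl _⟩]
    · rw [if_neg hij, if_neg (not_nonempty_iff.2 (inequiv j i (Ne.symm hij)))]
  have hs : ∑ g, ∑ i, (Φ i).character g = 0 := by
    rw [Finset.sum_comm]
    exact Finset.sum_eq_zero fun i _ => h0 i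
  have hs' : ∑ g, ∑ i, (Φ i).character g⁻¹ = 0 := by
    rw [Finset.sum_comm]
    exact Finset.sum_eq_zero fun i _ => h0' i
  refine ⟨?_, ?_, ?_⟩
  · rify
    have : (∑ g, (Nat.card {x // τ g x = x} : ℂ)) = Nat.card G := by
      simp only [hX, Finset.sum_add_distrib, hs]
      simp
    exact_mod_cast this
  · have : (∑ g, (Nat.card {x // τ g x = x} : ℂ) * Nat.card {x // τ g⁻¹ x = x}) =
        (n + 1) * Nat.card G := by
      simp only [hX, add_mul, mul_add, one_mul, mul_one, Finset.sum_add_distrib, hs, hs',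
        Finset.sum_mul_sum]
      rw [Finset.sum_comm]
      simp_rw [Finset.sum_comm (s := Finset.univ (α := G)), h1]
      simp
    simp only [hinv, ← sq] at this
    exact_mod_cast this
  · have : (∑ g, (Nat.card {x // τ g x = x} : ℂ) * Nat.card {x // ψ g⁻¹ x = x}) =
        2 * Nat.card G := by
      simp only [hX, hP, add_mul, mul_add, one_mul, mul_one, Finset.sum_add_distrib, hs, h0',
        Finset.sum_mul]
      rw [Finset.sum_comm]
      simp_rw [h1]
      simp
      ring
    simp only [hinv'] at this
    exact_mod_cast this

/-! ### Consequences of the fixed-point counts. -/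

/-- The function fix² - (q - 1) · fix vanishes off the identity. Its sum is q|G| - (q - 1)|G| = |G|
on one side and its value at `1` on the other. -/
theorem card_group_of_sum_card_fixed {G X : Type*} [Group G] [Fintype G] [Fintype X]
    [MulAction G X] (q : ℕ) (hq : 2 ≤ q) (hX : Nat.card X = q ^ 2 - 1)
    (hfix : ∀ g : G, g ≠ 1 →
      Nat.card {x : X // g • x = x} = 0 ∨ Nat.card {x : X // g • x = x} = q - 1)
    (h1 : ∑ g : G, Nat.card {x : X // g • x = x} = Nat.card G)
    (h2 : ∑ g : G, Nat.card {x : X // g • x = x} ^ 2 = q * Nat.card G) :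
    Nat.card G = (q ^ 2 - 1) * (q * (q - 1)) := by
  classical
  obtain ⟨r, rfl⟩ : ∃ r, q = r + 1 := ⟨q - 1, by omega⟩
  have key : ∀ g : G, (Nat.card {x : X // g • x = x} : ℤ) ^ 2 -
      r * Nat.card {x : X // g • x = x} =
      if g = 1 then ((r + 1) ^ 2 - 1) * ((r + 1) * r : ℤ) else 0 := by
    intro g
    split_ifs with hg
    · subst hg
      have : Nat.card {x : X // (1 : G) • x = x} = (r + 1) ^ 2 - 1 := by simp [← hX]
      rw [this, Nat.cast_sub (by nlinarith)]
      push_cast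
      ring
    · rcases hfix g hg with h | h <;> rw [h] <;> push_cast [Nat.add_sub_cancel] <;> ring
  have hs := Finset.sum_congr rfl fun g (_ : g ∈ Finset.univ) => key g
  rw [Finset.sum_sub_distrib, ← Finset.mul_sum, Finset.sum_ite_eq' Finset.univ (1 : G)] at hs
  simp only [Finset.mem_univ, if_true] at hs
  have h1' : (∑ g : G, (Nat.card {x : X // g • x = x} : ℤ)) = Nat.card G := by exact_mod_cast h1
  have h2' : (∑ g : G, (Nat.card {x : X // g • x = x} : ℤ) ^ 2) = (r + 1) * Nat.card G := by
    exact_mod_cast h2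
  rw [h1', h2'] at hs
  zify [show 1 ≤ (r + 1) ^ 2 by nlinarith, show 1 ≤ r + 1 by omega]
  linarith

theorem isPretransitive_of_sum_card_fixed {G X : Type*} [Group G] [Fintype G] [Fintype X]
    [MulAction G X] (h1 : ∑ g : G, Nat.card {x : X // g • x = x} = Nat.card G) :
    MulAction.IsPretransitive G X := by
  classical
  have h := MulAction.sum_card_fixedBy_eq_card_orbits_mul_card_group G X
  have h' : ∑ g : G, Fintype.card (MulAction.fixedBy X g) = Nat.card G := by
    rw [← h1]
    exact Finset.sum_congr rfl fun g _ => Nat.card_eq_fintype_card.symm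
  rw [h', Nat.card_eq_fintype_card] at h
  have hc : Fintype.card (Quotient (MulAction.orbitRel G X)) = 1 :=
    Nat.eq_of_mul_eq_mul_right Fintype.card_pos (by rw [one_mul]; exact h.symm)
  rw [Fintype.card_eq_one_iff_nonempty_unique] at hc
  obtain ⟨hc⟩ := hc
  exact MulAction.pretransitive_iff_subsingleton_quotient G X |>.2 inferInstance

/-- A normal subgroup of order `q - 1` in a transitive group on `q ^ 2 - 1` points, each of whose
nontrivial elements fixes at most `q - 1` points, acts semiregularly. -/
theorem eq_one_of_normal_of_fixed {G X : Type*} [Group G] [Fintype G] [Fintype X]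
    [MulAction G X] [MulAction.IsPretransitive G X] (q : ℕ) (hq : 2 ≤ q)
    (hX : Nat.card X = q ^ 2 - 1)
    (hfix : ∀ g : G, g ≠ 1 → Nat.card {x : X // g • x = x} ≤ q - 1)
    (K : Subgroup G) [K.Normal] (hK : Nat.card K = q - 1) (k : G) (hk : k ∈ K) (x : X)
    (hkx : k • x = x) : k = 1 := by
  classical
  obtain ⟨r, rfl⟩ : ∃ r, q = r + 1 := ⟨q - 1, by omega⟩
  simp only [Nat.add_sub_cancel] at *
  -- `K` is normal and `G` transitive, so the stabilizers in `K` of any two points are conjugate.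
  have hconst : ∀ y : X, Nat.card {k : K // k • y = y} = Nat.card {k : K // k • x = x} := by
    intro y
    obtain ⟨g, rfl⟩ := MulAction.exists_smul_eq G x y
    refine (Nat.card_congr
      ((MulAut.conjNormal (H := K) g).toEquiv.subtypeEquiv fun k => ?_)).symm
    simp only [Subgroup.smul_def]
    simp [mul_smul, ← Subgroup.smul_def]
  have hdc : ∑ k : K, Nat.card {y : X // k • y = y} = ∑ y : X, Nat.card {k : K // k • y = y} := by
    simp only [Nat.card_eq_fintype_card, Fintype.card_subtype]
    exact Finset.sum_card_bipartiteAbove_eq_sum_card_bipartiteBelow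
      (fun (k : K) (y : X) => k • y = y)
  simp only [hconst, Finset.sum_const, Finset.card_univ, smul_eq_mul] at hdc
  rw [← Nat.card_eq_fintype_card, hX] at hdc
  have hle : ∑ k : K, Nat.card {y : X // k • y = y} ≤
      ∑ k : K, if k = 1 then (r + 1) ^ 2 - 1 else r := by
    refine Finset.sum_le_sum fun k _ => ?_
    split_ifs with h
    · subst h
      simp [← hX]
    · exact hfix k (by simpa using h)
  have hcard : ∑ k : K, (if k = 1 then (r + 1) ^ 2 - 1 else r) = (r + 1) ^ 2 - 1 + (r - 1) * r := by
    rw [Finset.sum_ite, Finset.filter_eq' , if_pos (Finset.mem_univ _)]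
    simp only [Finset.sum_const, Finset.card_singleton, smul_eq_mul, one_mul]
    congr 2
    rw [Finset.filter_not, Finset.filter_eq', if_pos (Finset.mem_univ _),
      Finset.card_sdiff_of_subset (by simp), Finset.card_univ, ← Nat.card_eq_fintype_card, hK,
      Finset.card_singleton]
  rw [hcard, hdc] at hle
  have hone : Nat.card {k : K // k • x = x} ≤ 1 := by
    by_contra! h
    -- Counting incident pairs in `K × X`: stabilizers of order at least 2 would force 2(q² - 1) ≤
    -- (q² - 1) + (q - 2)(q - 1), which is false.
    have h3 : ((r + 1) ^ 2 - 1) * 2 ≤ (r + 1) ^ 2 - 1 + (r - 1) * r :=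
      (Nat.mul_le_mul_left _ h).trans hle
    obtain ⟨s, rfl⟩ : ∃ s, r = s + 1 := ⟨r - 1, by omega⟩
    have h4 : (s + 1 + 1) ^ 2 - 1 = s ^ 2 + 4 * s + 3 := by
      rw [Nat.sub_eq_iff_eq_add (by nlinarith)]
      ring
    rw [h4, Nat.add_sub_cancel] at h3
    nlinarith
  have := Finite.card_le_one_iff_subsingleton.1 hone
  have h5 := Subsingleton.elim (α := {k : K // k • x = x}) ⟨⟨k, hk⟩, hkx⟩ ⟨1, one_smul _ _⟩
  simpa using h5

/-! ### The action of GL₂ on the projective line. -/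

section ProjectiveLine

variable {F : Type*} [Field F]

variable (F) in
/-- The action of `GL₂` on the lines of the plane. -/
def linePerm : GL (Fin 2) F →* Equiv.Perm (ℙ F (Fin 2 → F)) :=
  MulAction.toPermHom _ _

/-- The line spanned by a nonzero vector. -/
abbrev lineOf (v : Fin 2 → F) (hv : v ≠ 0) : ℙ F (Fin 2 → F) := Projectivization.mk F v hv

theorem GL_mulVec_ne_zero (A : GL (Fin 2) F) {v : Fin 2 → F} (hv : v ≠ 0) :
    (A : Matrix (Fin 2) (Fin 2) F).mulVec v ≠ 0 :=
  (smul_ne_zero_iff_ne A).2 hv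

theorem linePerm_lineOf (A : GL (Fin 2) F) {v : Fin 2 → F} (hv : v ≠ 0) :
    linePerm F A (lineOf v hv) =
      lineOf ((A : Matrix (Fin 2) (Fin 2) F).mulVec v) (GL_mulVec_ne_zero A hv) :=
  rfl

theorem pglOnLines_eq : pglOnLines F = (linePerm F).range := by
  ext p
  constructor
  · rintro ⟨g, rfl⟩
    induction g using Matrix.ProjGenLinGroup.induction_on with | mk g =>
    exact ⟨g, rfl⟩
  · rintro ⟨A, rfl⟩
    exact ⟨Matrix.ProjGenLinGroup.mk A, rfl⟩

theorem lineOf_eq_lineOf_iff {v w : Fin 2 → F} (hv : v ≠ 0) (hw : w ≠ 0) :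
    lineOf v hv = lineOf w hw ↔ v 0 * w 1 = v 1 * w 0 := by
  rw [Projectivization.mk_eq_mk_iff']
  constructor
  · rintro ⟨c, rfl⟩
    simp
    ring
  · intro h
    by_cases h0 : w 0 = 0
    · have h1 : w 1 ≠ 0 := fun h1 => hw (by ext i; fin_cases i <;> simp [h0, h1])
      refine ⟨v 1 / w 1, ?_⟩
      ext i
      fin_cases i
      · have : v 0 = 0 := by simpa [h0, h1] using h
        simp [h0, this]
      · simp [h1]
    · refine ⟨v 0 / w 0, ?_⟩
      ext i
      fin_cases i
      · simp [h0]
      · simp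
        field_simp
        linear_combination h

theorem vec_one_ne_zero (s : F) : (![s, 1] : Fin 2 → F) ≠ 0 := fun h => by
  simpa using congrFun h 1

theorem one_vec_ne_zero (s : F) : (![1, s] : Fin 2 → F) ≠ 0 := fun h => by
  simpa using congrFun h 0

variable (F) in
/-- The line of the first coordinate vector. -/
def lineInf : ℙ F (Fin 2 → F) := lineOf ![1, 0] (one_vec_ne_zero 0)

/-- The line of slope given by its first coordinate. -/
def lineAt (s : F) : ℙ F (Fin 2 → F) := lineOf ![s, 1] (vec_one_ne_zero s)

theorem lineAt_injective : Function.Injective (lineAt : F → ℙ F (Fin 2 → F)) := fun s t h => by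
  simpa [lineAt, lineOf_eq_lineOf_iff] using h

theorem lineAt_ne_lineInf (s : F) : lineAt s ≠ lineInf F := fun h => by
  simp [lineAt, lineInf, lineOf_eq_lineOf_iff] at h

theorem lineOf_eq_lineInf {v : Fin 2 → F} (hv : v ≠ 0) (h : v 1 = 0) :
    lineOf v hv = lineInf F := by
  simp [lineInf, lineOf_eq_lineOf_iff, h]

theorem lineOf_eq_lineAt {v : Fin 2 → F} (hv : v ≠ 0) (h : v 1 ≠ 0) :
    lineOf v hv = lineAt (v 0 / v 1) := by
  simp [lineAt, lineOf_eq_lineOf_iff]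
  field_simp

theorem eq_lineInf_or_lineAt (l : ℙ F (Fin 2 → F)) : l = lineInf F ∨ ∃ s, l = lineAt s := by
  induction l using Projectivization.ind with | h v hv =>
  by_cases h : v 1 = 0
  · exact .inl (lineOf_eq_lineInf hv h)
  · exact .inr ⟨_, lineOf_eq_lineAt hv h⟩

/-- Diagonal matrices. -/
def diagGL (x y : Fˣ) : GL (Fin 2) F :=
  Matrix.GeneralLinearGroup.mkOfDetNeZero !![(x : F), 0; 0, (y : F)] (by simp)

/-- Upper unitriangular matrices. -/
def unipGL (s : F) : GL (Fin 2) F :=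
  Matrix.GeneralLinearGroup.mkOfDetNeZero !![1, s; 0, 1] (by simp)

variable (F) in
/-- The matrix exchanging the coordinates. -/
def swapGL : GL (Fin 2) F :=
  Matrix.GeneralLinearGroup.mkOfDetNeZero !![0, 1; 1, 0] (by simp)

theorem coe_diagGL (x y : Fˣ) :
    (diagGL x y : Matrix (Fin 2) (Fin 2) F) = !![(x : F), 0; 0, (y : F)] := rfl

theorem coe_unipGL (s : F) : (unipGL s : Matrix (Fin 2) (Fin 2) F) = !![1, s; 0, 1] := rfl

theorem coe_swapGL : (swapGL F : Matrix (Fin 2) (Fin 2) F) = !![0, 1; 1, 0] := rfl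

theorem diagGL_mul (x y x' y' : Fˣ) : diagGL x y * diagGL x' y' = diagGL (x * x') (y * y') := by
  ext i j
  fin_cases i <;> fin_cases j <;> simp [coe_diagGL]

theorem diagGL_one : diagGL (1 : Fˣ) 1 = 1 := by
  ext i j
  fin_cases i <;> fin_cases j <;> simp [coe_diagGL]

theorem diagGL_pow (x y : Fˣ) (n : ℕ) : diagGL x y ^ n = diagGL (x ^ n) (y ^ n) := by
  induction n with
  | zero => simp [diagGL_one]
  | succ n ih => rw [pow_succ, ih, diagGL_mul, pow_succ, pow_succ]

theorem unipGL_mul (s t : F) : unipGL s * unipGL t = unipGL (s + t) := by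
  ext i j
  fin_cases i <;> fin_cases j <;> simp [coe_unipGL, add_comm]

theorem diagGL_mul_unipGL (x y : Fˣ) (s : F) :
    diagGL x y * unipGL s = unipGL (x * s / y) * diagGL x y := by
  ext i j
  fin_cases i <;> fin_cases j <;> simp [coe_unipGL, coe_diagGL]

theorem swapGL_mul_diagGL (x y : Fˣ) : swapGL F * diagGL x y = diagGL y x * swapGL F := by
  ext i j
  fin_cases i <;> fin_cases j <;> simp [coe_swapGL, coe_diagGL]

theorem swapGL_mul_swapGL : swapGL F * swapGL F = 1 := by
  ext i j
  fin_cases i <;> fin_cases j <;> simp [coe_swapGL]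

theorem linePerm_diagGL_lineInf (x y : Fˣ) : linePerm F (diagGL x y) (lineInf F) = lineInf F := by
  rw [lineInf, linePerm_lineOf, lineOf_eq_lineOf_iff]
  simp [coe_diagGL]

theorem linePerm_diagGL_lineAt (x y : Fˣ) (s : F) :
    linePerm F (diagGL x y) (lineAt s) = lineAt (x * s / y) := by
  rw [lineAt, linePerm_lineOf, lineAt, lineOf_eq_lineOf_iff]
  simp [coe_diagGL]
  field_simp

theorem linePerm_unipGL_lineInf (s : F) : linePerm F (unipGL s) (lineInf F) = lineInf F := by
  rw [lineInf, linePerm_lineOf, lineOf_eq_lineOf_iff]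
  simp [coe_unipGL]

theorem linePerm_unipGL_lineAt (s t : F) :
    linePerm F (unipGL s) (lineAt t) = lineAt (s + t) := by
  rw [lineAt, linePerm_lineOf, lineAt, lineOf_eq_lineOf_iff]
  simp [coe_unipGL, add_comm]

theorem linePerm_swapGL_lineInf : linePerm F (swapGL F) (lineInf F) = lineAt 0 := by
  rw [lineInf, linePerm_lineOf, lineAt, lineOf_eq_lineOf_iff]
  simp [coe_swapGL]

theorem linePerm_swapGL_lineAt_zero : linePerm F (swapGL F) (lineAt 0) = lineInf F := by
  rw [lineInf, lineAt, linePerm_lineOf, lineOf_eq_lineOf_iff]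
  simp [coe_swapGL]

theorem linePerm_swapGL_lineAt {s : F} (hs : s ≠ 0) :
    linePerm F (swapGL F) (lineAt s) = lineAt s⁻¹ := by
  rw [lineAt, linePerm_lineOf, lineAt, lineOf_eq_lineOf_iff]
  simp [coe_swapGL, hs]

theorem eq_diagGL_of_fixes {A : GL (Fin 2) F} (h₁ : linePerm F A (lineInf F) = lineInf F)
    (h₂ : linePerm F A (lineAt 0) = lineAt 0) : ∃ x y, A = diagGL x y := by
  rw [lineInf, linePerm_lineOf, lineOf_eq_lineOf_iff] at h₁
  rw [lineAt, linePerm_lineOf, lineOf_eq_lineOf_iff] at h₂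
  replace h₁ : A 1 0 = 0 := by simpa [Matrix.mulVec, dotProduct, eq_comm] using h₁
  replace h₂ : A 0 1 = 0 := by simpa [Matrix.mulVec, dotProduct, eq_comm] using h₂
  have hdet : A 0 0 * A 1 1 ≠ 0 := by
    have := A.det_ne_zero
    rw [Matrix.det_fin_two] at this
    simpa [h₁, h₂] using this
  refine ⟨.mk0 (A 0 0) (left_ne_zero_of_mul hdet), .mk0 (A 1 1) (right_ne_zero_of_mul hdet), ?_⟩
  ext i j
  fin_cases i <;> fin_cases j <;> simp [coe_diagGL, h₁, h₂]

theorem linePerm_eq_one_iff {A : GL (Fin 2) F} : linePerm F A = 1 ↔ ∃ x, A = diagGL x x := by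
  constructor
  · intro h
    obtain ⟨x, y, rfl⟩ := eq_diagGL_of_fixes (A := A) (by simp [h]) (by simp [h])
    have := linePerm_diagGL_lineAt x y 1
    rw [h, Equiv.Perm.one_apply] at this
    have := lineAt_injective this
    refine ⟨x, ?_⟩
    have : x = y := by
      ext
      field_simp at this
      simpa using this.symm
    rw [this]
  · rintro ⟨x, rfl⟩
    ext l
    rcases eq_lineInf_or_lineAt l with rfl | ⟨s, rfl⟩
    · simp [linePerm_diagGL_lineInf]
    · simp [linePerm_diagGL_lineAt]

theorem exists_linePerm_eq {l m : ℙ F (Fin 2 → F)} (h : l ≠ m) :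
    ∃ A, linePerm F A (lineInf F) = l ∧ linePerm F A (lineAt 0) = m := by
  have h2 : MulAction.IsMultiplyPretransitive (Matrix.SpecialLinearGroup (Fin 2) F)
    (ℙ F (Fin 2 → F)) 2 := inferInstance
  rw [MulAction.is_two_pretransitive_iff] at h2
  obtain ⟨g, h⟩ := h2 (lineAt_ne_lineInf 0).symm h
  exact ⟨(g : GL (Fin 2) F), h⟩

theorem card_lines [Fintype F] : Nat.card (ℙ F (Fin 2 → F)) = Fintype.card F + 1 := by
  rw [Projectivization.card_of_finrank_two _ _ (by simp), Nat.card_eq_fintype_card]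

theorem card_range_linePerm [Fintype F] : Nat.card (linePerm F).range =
    Fintype.card F * (Fintype.card F ^ 2 - 1) := by
  classical
  have hq : 1 < Fintype.card F := Fintype.one_lt_card
  have h1 := Matrix.card_GL_field (𝔽 := F) 2
  have h2 := Subgroup.card_mul_index (linePerm F).ker
  rw [Subgroup.index_ker] at h2
  have h3 : Nat.card (linePerm F).ker = Fintype.card F - 1 := by
    rw [← Fintype.card_units, ← Nat.card_eq_fintype_card]
    refine (Nat.card_congr (Equiv.ofBijective
      (fun x : Fˣ => (⟨diagGL x x, linePerm_eq_one_iff.2 ⟨x, rfl⟩⟩ : (linePerm F).ker))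
      ⟨fun x y h => ?_, fun ⟨A, hA⟩ => ?_⟩)).symm
    · have h : diagGL x x = diagGL y y := congrArg Subtype.val h
      ext
      simpa [coe_diagGL] using congrArg (fun A : GL (Fin 2) F => A 0 0) h
    · obtain ⟨x, rfl⟩ := linePerm_eq_one_iff.1 hA
      exact ⟨x, rfl⟩
  rw [h3, h1] at h2
  simp only [Fin.prod_univ_two] at h2
  have h4 : 0 < Fintype.card F - 1 := by omega
  apply Nat.eq_of_mul_eq_mul_left h4
  rw [h2]
  simp only [Fin.val_zero, pow_zero, Fin.val_one, pow_one]
  rw [sq, ← Nat.mul_sub_one]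
  ring

/-- By double transitivity the two lines may be taken to be the coordinate axes. The matrix is then
diagonal, with entries in a group of order `q - 1`. -/
theorem pow_eq_one_of_fixes_two_lines [Fintype F] {p : Equiv.Perm (ℙ F (Fin 2 → F))}
    (hp : p ∈ (linePerm F).range) {l m : ℙ F (Fin 2 → F)} (hlm : l ≠ m) (hl : p l = l)
    (hm : p m = m) : p ^ (Fintype.card F - 1) = 1 := by
  classical
  obtain ⟨A, rfl⟩ := hp
  obtain ⟨B, rfl, rfl⟩ := exists_linePerm_eq hlm
  obtain ⟨x, y, h⟩ := eq_diagGL_of_fixes (A := B⁻¹ * A * B)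
    (by simp [hl]) (by simp [hm])
  have hA : A = B * diagGL x y * B⁻¹ := by rw [← h]; group
  rw [← map_pow, hA, conj_pow, diagGL_pow, ← Fintype.card_units, pow_card_eq_one,
    pow_card_eq_one, diagGL_one]
  simp

end ProjectiveLine

/-! ### From counts to an equivariant map from points to lines. -/

/-- If the product of two permutation characters has inner product different from `1` with the
trivial character, then the point stabilizers of the first action are not transitive on the
second one. -/
theorem exists_stabilizer_not_transitive {G X P : Type*} [Group G] [Fintype G] [Fintype X]
    [Fintype P] [Nonempty P] [MulAction G X] [MulAction.IsPretransitive G X]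
    (ψ : G →* Equiv.Perm P)
    (h : ∑ g : G, Nat.card {x : X // g • x = x} * Nat.card {x // ψ g x = x} = 2 * Nat.card G)
    (a : X) : ∃ l m, ∀ g : G, g • a = a → ψ g l ≠ m := by
  classical
  by_contra! hc
  let _ : MulAction G P := MulAction.compHom P ψ
  have hsm : ∀ (g : G) (l : P), g • l = ψ g l := fun g l => rfl
  -- A transitive stabilizer would make `G` transitive on `X × P`. The permutation character there
  -- is the product of the two, so its average would be `1`.
  have htr : MulAction.IsPretransitive G (X × P) := by
    refine (MulAction.isPretransitive_iff_base (a, Classical.arbitrary P)).2 fun p => ?_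
    obtain ⟨g, hg⟩ := MulAction.exists_smul_eq G a p.1
    obtain ⟨h, hh, hl⟩ := hc (Classical.arbitrary P) (g⁻¹ • p.2)
    refine ⟨g * h, Prod.ext ?_ ?_⟩
    · rw [Prod.smul_fst, mul_smul, hh, hg]
    · rw [Prod.smul_snd, mul_smul, hsm h, hl, smul_inv_smul]
  have hb := MulAction.sum_card_fixedBy_eq_card_orbits_mul_card_group G (X × P)
  have hb' : ∑ g : G, Fintype.card (MulAction.fixedBy (X × P) g) = 2 * Nat.card G := by
    rw [← h]
    refine Finset.sum_congr rfl fun g _ => ?_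
    rw [← Nat.card_prod, ← Nat.card_eq_fintype_card]
    refine Nat.card_congr ?_
    refine (Equiv.subtypeEquivRight fun p => ?_).trans Equiv.subtypeProdEquivProd
    simp [MulAction.mem_fixedBy, Prod.ext_iff, hsm]
  rw [hb', Nat.card_eq_fintype_card] at hb
  have hs := (MulAction.pretransitive_iff_subsingleton_quotient G (X × P)).1 htr
  have h1 : Fintype.card (Quotient (MulAction.orbitRel G (X × P))) ≤ 1 :=
    Fintype.card_le_one_iff_subsingleton.2 hs
  have h2 : 0 < Fintype.card G := Fintype.card_pos
  nlinarith

/-- A finite group acting on a set in the way in which `GL₂` acts on the nonzero vectors of a plane: it permutes the lines like `PGL₂`, points are attached equivariantly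
to lines, the kernel on lines is simply transitive on each fibre, and a nontrivial element with a
fixed point has exactly `q - 1` of them. -/
structure PlaneAction (F G X : Type*) [Field F] [Group G] [MulAction G X] where
  /-- The action on lines. -/
  perm : G →* Equiv.Perm (ℙ F (Fin 2 → F))
  range_perm : perm.range = (linePerm F).range
  /-- The line through a point. -/
  line : X → ℙ F (Fin 2 → F)
  line_smul : ∀ g x, line (g • x) = perm g (line x)
  line_surjective : Function.Surjective line
  exists_ker_smul : ∀ x y, line x = line y → ∃ k : G, perm k = 1 ∧ k • x = y
  eq_one_of_smul : ∀ (k : G) (x : X), perm k = 1 → k • x = x → k = 1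
  card_fixed : ∀ (g : G) (x : X), g ≠ 1 → g • x = x →
    Nat.card {y : X // g • y = y} = Nat.card F - 1
  card_fibre : ∀ l, Nat.card {x // line x = l} = Nat.card F - 1
  card_ker : Nat.card perm.ker = Nat.card F - 1

section LineMap

variable {F G X : Type*} [Field F] [Fintype F] [Group G] [Fintype G] [Fintype X] [MulAction G X]
  [MulAction.IsPretransitive G X] (ψ : G →* Equiv.Perm (ℙ F (Fin 2 → F)))

/-- Under the numerical conditions, a point stabilizer fixes a line and is transitive on the
others. -/
theorem exists_line_fixed_by_stabilizer
    (hψ : ψ.range ≤ (linePerm F).range)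
    (hX : Nat.card X = Nat.card F ^ 2 - 1)
    (hG : Nat.card G = (Nat.card F ^ 2 - 1) * (Nat.card F * (Nat.card F - 1)))
    (hK : ∀ k (x : X), ψ k = 1 → k • x = x → k = 1)
    (h2 : ∑ g : G, Nat.card {x : X // g • x = x} * Nat.card {x // ψ g x = x} = 2 * Nat.card G)
    (a : X) : ∃ l, (∀ g : G, g • a = a → ψ g l = l) ∧
      ∀ m m', m ≠ l → m' ≠ l → ∃ g : G, g • a = a ∧ ψ g m = m' := by
  classical
  have hfin : Finite (ℙ F (Fin 2 → F)) := inferInstance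
  have _ : Fintype (ℙ F (Fin 2 → F)) := Fintype.ofFinite _
  have hq1 : 1 < Nat.card F := Finite.one_lt_card
  have hlines : Nat.card (ℙ F (Fin 2 → F)) = Nat.card F + 1 := by
    rw [card_lines, Nat.card_eq_fintype_card]
  obtain ⟨p, hp⟩ := CharP.exists F
  obtain ⟨n, hpp, hn⟩ := FiniteField.card F p
  have hpf : Fact p.Prime := ⟨hpp⟩
  rw [← Nat.card_eq_fintype_card] at hn
  have hH : Nat.card (MulAction.stabilizer G a) = Nat.card F * (Nat.card F - 1) := by
    have h := Subgroup.card_mul_index (MulAction.stabilizer G a)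
    rw [MulAction.index_stabilizer_of_transitive, hX, hG, mul_comm] at h
    refine Nat.eq_of_mul_eq_mul_left ?_ h
    have := Nat.one_lt_pow two_ne_zero hq1
    omega
  obtain ⟨S, hS⟩ := Sylow.exists_subgroup_card_pow_prime p (G := MulAction.stabilizer G a)
    (n := n) (by rw [hH, hn]; exact dvd_mul_right _ _)
  rw [← hn] at hS
  let φ : S →* Equiv.Perm (ℙ F (Fin 2 → F)) :=
    ψ.comp ((MulAction.stabilizer G a).subtype.comp S.subtype)
  let _ : MulAction S (ℙ F (Fin 2 → F)) := MulAction.compHom _ φ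
  have hsm : ∀ (s : S) l, s • l = ψ (s : MulAction.stabilizer G a) l := fun s l => rfl
  have hpg : IsPGroup p S := IsPGroup.of_card (hS.trans hn)
  have hmod := hpg.card_modEq_card_fixedPoints (ℙ F (Fin 2 → F))
  -- The number of lines is q + 1 ≡ 1 mod p.
  have hne : (MulAction.fixedPoints S (ℙ F (Fin 2 → F))).Nonempty := by
    by_contra hemp
    rw [Set.not_nonempty_iff_eq_empty] at hemp
    rw [hemp, hlines] at hmod
    simp only [Nat.card_eq_fintype_card, Fintype.card_eq_zero] at hmod
    have h1 : p ∣ Fintype.card F + 1 := (Nat.modEq_zero_iff_dvd).1 hmod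
    have h3 : p ∣ Fintype.card F := by
      rw [← Nat.card_eq_fintype_card, hn]
      exact dvd_pow_self _ n.ne_zero
    exact hpp.one_lt.ne' (Nat.dvd_one.1 ((Nat.dvd_add_right h3).1 h1))
  obtain ⟨l, hl⟩ := hne
  -- Fixing two lines, `s` acts on lines with order dividing `q - 1`. Its order also divides |S| =
  -- q, so it lies in the kernel; as it fixes `a`, it is trivial.
  have hfree : ∀ s : S, ∀ m, m ≠ l → s • m = m → s = 1 := fun s m hm hs => by
    have h1 := pow_eq_one_of_fixes_two_lines (hψ ⟨(s : MulAction.stabilizer G a), rfl⟩) hm hs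
      (hl s)
    rw [← Nat.card_eq_fintype_card, ← map_pow] at h1
    have h3 : s ^ Nat.card F = 1 := by rw [← hS]; exact pow_card_eq_one'
    have h4 : ((s : MulAction.stabilizer G a) : G) ^ Nat.card F = 1 := by
      exact_mod_cast congrArg (fun s : S => ((s : MulAction.stabilizer G a) : G)) h3
    have h5 : ψ (s : MulAction.stabilizer G a) = 1 := by
      have := congrArg ψ h4
      rw [← Nat.sub_add_cancel hq1.le, pow_succ, map_mul, h1, one_mul, map_one] at this
      exact this
    have h6 := hK _ a h5 (s : MulAction.stabilizer G a).2
    exact Subtype.ext (Subtype.ext h6)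
  have htrans : ∀ m m', m ≠ l → m' ≠ l → ∃ s : S, s • m = m' := by
    intro m m' hm hm'
    have hstay : ∀ s : S, s • m ≠ l := fun s h => hm (by
      rw [← hl s] at h
      exact MulAction.injective s h)
    let f : S → {m // m ≠ l} := fun s => ⟨s • m, hstay s⟩
    have hinj : Function.Injective f := fun s t h => by
      have h : s • m = t • m := congrArg Subtype.val h
      have := hfree (t⁻¹ * s) m hm (by rw [mul_smul, h, inv_smul_smul])
      exact (inv_mul_eq_one.1 this).symm
    have hcard : Nat.card S = Nat.card {m // m ≠ l} := by
      rw [hS, Nat.card_eq_fintype_card (α := {m // m ≠ l}), Fintype.card_subtype_compl,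
        Fintype.card_subtype_eq, ← Nat.card_eq_fintype_card, hlines, Nat.add_sub_cancel]
    have hbij := (Nat.bijective_iff_injective_and_card f).2 ⟨hinj, hcard⟩
    obtain ⟨s, hs⟩ := hbij.2 ⟨m', hm'⟩
    exact ⟨s, congrArg Subtype.val hs⟩
  refine ⟨l, ?_, fun m m' hm hm' => ?_⟩
  -- If the stabilizer moved `l`, then `S` would carry the image of `l` to every other line. The
  -- stabilizer would be transitive on lines, which the average `2` excludes.
  · by_contra! hc
    obtain ⟨g, hg, hgl⟩ := hc
    obtain ⟨u, v, huv⟩ := exists_stabilizer_not_transitive ψ h2 a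
    have key : ∀ m, ∃ h : G, h • a = a ∧ ψ h l = m := fun m => by
      by_cases hm : m = l
      · exact ⟨1, by simp, by simp [hm]⟩
      · obtain ⟨s, hs⟩ := htrans _ _ hgl hm
        refine ⟨(s : MulAction.stabilizer G a) * g, ?_, ?_⟩
        · rw [mul_smul, hg]
          exact (s : MulAction.stabilizer G a).2
        · rw [map_mul, Equiv.Perm.mul_apply]
          exact hs
    obtain ⟨h, h1, h3⟩ := key u
    obtain ⟨h', h1', h3'⟩ := key v
    refine huv (h' * h⁻¹) ?_ ?_
    · rw [mul_smul, inv_smul_eq_iff.2 h1.symm, h1']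
    · simp [← h3, ← h3']
  · obtain ⟨s, hs⟩ := htrans m m' hm hm'
    exact ⟨(s : MulAction.stabilizer G a), (s : MulAction.stabilizer G a).2, hs⟩

/-- The numerical conditions yield a plane action. -/
theorem exists_planeAction [FaithfulSMul G X]
    (hψ : ψ.range = (linePerm F).range)
    (hX : Nat.card X = Nat.card F ^ 2 - 1)
    (hfix : ∀ g : G, g ≠ 1 → Nat.card {x : X // g • x = x} = 0 ∨
      Nat.card {x : X // g • x = x} = Nat.card F - 1)
    (h0 : ∑ g : G, Nat.card {x : X // g • x = x} ^ 2 = Nat.card F * Nat.card G)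
    (h1 : ∑ g : G, Nat.card {x : X // g • x = x} = Nat.card G)
    (h2 : ∑ g : G, Nat.card {x : X // g • x = x} * Nat.card {x // ψ g x = x} = 2 * Nat.card G) :
    Nonempty (PlaneAction F G X) := by
  classical
  have _ : Fintype (ℙ F (Fin 2 → F)) := Fintype.ofFinite _
  have hq1 : 1 < Nat.card F := Finite.one_lt_card
  have hsq : Nat.card F ^ 2 - 1 = (Nat.card F + 1) * (Nat.card F - 1) := by
    simpa using Nat.sq_sub_sq (Nat.card F) 1
  have hlines : Nat.card (ℙ F (Fin 2 → F)) = Nat.card F + 1 := by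
    rw [card_lines, Nat.card_eq_fintype_card]
  have hG := card_group_of_sum_card_fixed _ hq1 hX hfix h1 h0
  have hcK : Nat.card ψ.ker = Nat.card F - 1 := by
    have h := Subgroup.card_mul_index ψ.ker
    rw [Subgroup.index_ker, hψ, card_range_linePerm, hG, ← Nat.card_eq_fintype_card] at h
    have hpos : 0 < Nat.card F * (Nat.card F ^ 2 - 1) := by
      rw [hsq]
      exact Nat.mul_pos (by omega) (Nat.mul_pos (by omega) (by omega))
    apply Nat.eq_of_mul_eq_mul_right hpos
    rw [h]
    ring
  have hK : ∀ k (x : X), ψ k = 1 → k • x = x → k = 1 := fun k x hk hx =>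
    eq_one_of_normal_of_fixed _ hq1 hX
      (fun g hg => by rcases hfix g hg with h | h <;> omega) ψ.ker hcK k hk x hx
  choose line hline htrans using exists_line_fixed_by_stabilizer ψ hψ.le hX hG hK h2
  -- A second fixed line is impossible, since the stabilizer is transitive on the `q ≥ 2` lines
  -- other than `line a`. Uniqueness is what makes `line` equivariant.
  have huniq : ∀ a l, (∀ g : G, g • a = a → ψ g l = l) → l = line a := by
    intro a l h
    by_contra hl
    obtain ⟨m, hm⟩ : ∃ m, m ∉ ({l, line a} : Finset (ℙ F (Fin 2 → F))) := by
      apply Finset.exists_mem_notMem_of_card_lt_card (t := Finset.univ) _ |>.imp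
      · exact fun _ h => h.2
      · rw [Finset.card_univ, ← Nat.card_eq_fintype_card, hlines]
        exact Finset.card_le_two.trans_lt (by omega)
    simp only [Finset.mem_insert, Finset.mem_singleton, not_or] at hm
    obtain ⟨g, hg, hgm⟩ := htrans a l m hl hm.2
    exact hm.1 (hgm.symm.trans (h g hg))
  have hsmul : ∀ g x, line (g • x) = ψ g (line x) := fun g x => by
    refine (huniq _ _ fun h hh => ?_).symm
    have := hline x (g⁻¹ * h * g) (by rw [mul_smul, mul_smul, hh, inv_smul_smul])
    rw [map_mul, map_mul, Equiv.Perm.mul_apply, Equiv.Perm.mul_apply, map_inv,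
      Equiv.Perm.inv_eq_iff_eq] at this
    exact this
  have hne : Nonempty X := by
    rw [← Finite.card_pos_iff, hX, hsq]
    exact Nat.mul_pos (by omega) (by omega)
  have hPtrans : ∀ l m, ∃ g, ψ g l = m := fun l m => by
    by_cases hlm : l = m
    · exact ⟨1, by simp [hlm]⟩
    · obtain ⟨A, hA, hA'⟩ := exists_linePerm_eq hlm
      obtain ⟨B, hB, hB'⟩ := exists_linePerm_eq (Ne.symm hlm)
      obtain ⟨g, hg⟩ := hψ.ge ⟨B * A⁻¹, rfl⟩
      refine ⟨g, ?_⟩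
      simp [hg, ← hA, hB]
  have hsurj : Function.Surjective line := fun l => by
    obtain ⟨x⟩ := hne
    obtain ⟨g, hg⟩ := hPtrans (line x) l
    exact ⟨g • x, by rw [hsmul, hg]⟩
  have hfib : ∀ l, Nat.card {x // line x = l} = Nat.card F - 1 := by
    have hconst : ∀ l m, Nat.card {x // line x = l} = Nat.card {x // line x = m} := fun l m => by
      obtain ⟨g, rfl⟩ := hPtrans l m
      exact Nat.card_congr ((MulAction.toPerm g).subtypeEquiv fun x => by simp [hsmul])
    intro l
    have h := Nat.card_congr (Equiv.sigmaFiberEquiv line)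
    rw [Nat.card_sigma] at h
    simp only [fun m => hconst m l, Finset.sum_const, Finset.card_univ, smul_eq_mul] at h
    rw [← Nat.card_eq_fintype_card, hlines, hX, hsq] at h
    exact Nat.eq_of_mul_eq_mul_left (by omega) h
  refine ⟨{
    perm := ψ
    range_perm := hψ
    line := line
    line_smul := hsmul
    line_surjective := hsurj
    exists_ker_smul := fun x y hxy => ?_
    eq_one_of_smul := hK
    card_fixed := fun g x hg hgx => (hfix g hg).resolve_left fun h => ?_
    card_fibre := hfib
    card_ker := hcK }⟩
  · let f : ψ.ker → {z // line z = line x} := fun k => ⟨(k : G) • x, by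
      rw [hsmul, MonoidHom.mem_ker.1 k.2, Equiv.Perm.one_apply]⟩
    have hinj : Function.Injective f := fun s t h => by
      have h : (s : G) • x = (t : G) • x := congrArg Subtype.val h
      have := hK ((t : G)⁻¹ * s) x (ψ.ker.mul_mem (ψ.ker.inv_mem t.2) s.2)
        (by rw [mul_smul, h, inv_smul_smul])
      exact Subtype.ext (inv_mul_eq_one.1 this).symm
    have hbij := (Nat.bijective_iff_injective_and_card f).2 ⟨hinj, by rw [hcK, hfib]⟩
    obtain ⟨k, hk⟩ := hbij.2 ⟨y, hxy.symm⟩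
    exact ⟨k, k.2, congrArg Subtype.val hk⟩
  · have hpos : 0 < Nat.card {x : X // g • x = x} := by
      rw [Finite.card_pos_iff]
      exact ⟨⟨x, hgx⟩⟩
    omega

end LineMap

/-! ### Lifting matrices to the group. -/

namespace PlaneAction

variable {F G X : Type*} [Field F] [Group G] [MulAction G X] (S : PlaneAction F G X)

/-- The kernel on lines acts freely on points. Every relation between lifts below is checked through
this, at one point. -/
theorem eq_of_smul_eq {g h : G} (x : X) (hp : S.perm g = S.perm h) (hx : g • x = h • x) :
    g = h := by
  have := S.eq_one_of_smul (h⁻¹ * g) x (by simp [hp]) (by rw [mul_smul, hx, inv_smul_smul])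
  exact (inv_mul_eq_one.1 this).symm

theorem exists_perm_eq (A : GL (Fin 2) F) : ∃ g, S.perm g = linePerm F A :=
  S.range_perm.ge ⟨A, rfl⟩

theorem exists_lift (A : GL (Fin 2) F) {l : ℙ F (Fin 2 → F)} (a : X) (hl : S.line a = l)
    (h : linePerm F A l = l) :
    ∃ g, S.perm g = linePerm F A ∧ g • a = a := by
  subst hl
  obtain ⟨g, hg⟩ := S.exists_perm_eq A
  obtain ⟨k, hk, hka⟩ := S.exists_ker_smul (g • a) a (by rw [S.line_smul, hg, h])
  exact ⟨k * g, by rw [map_mul, hk, hg, one_mul], by rw [mul_smul, hka]⟩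

/-- An element fixing a fibre pointwise centralizes the kernel of the action on lines. -/
theorem commute_of_fixes_fibre {g : G} {l : ℙ F (Fin 2 → F)}
    (h : ∀ y, S.line y = l → g • y = y) {k : G} (hk : S.perm k = 1) : g * k = k * g := by
  obtain ⟨a, rfl⟩ := S.line_surjective l
  refine S.eq_of_smul_eq a (by simp [hk]) ?_
  rw [mul_smul, mul_smul, h a rfl, h (k • a) (by simp [S.line_smul, hk])]

theorem perm_fixes_line {g : G} {y : X} (h : g • y = y) : S.perm g (S.line y) = S.line y := by
  rw [← S.line_smul, h]

section Finite

variable [Finite X]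

/-- A nontrivial element with a fixed point, all of whose fixed points lie in one fibre, fixes
that fibre pointwise, and conversely. -/
theorem fixed_eq_fibre {g : G} (hg : g ≠ 1) {a : X} (ha : g • a = a) {l : ℙ F (Fin 2 → F)}
    (h : (∀ y, g • y = y → S.line y = l) ∨ (∀ y, S.line y = l → g • y = y)) (y : X) :
    g • y = y ↔ S.line y = l := by
  have hc : {y | g • y = y}.ncard = {y | S.line y = l}.ncard :=
    (S.card_fixed g a hg ha).trans (S.card_fibre l).symm
  have : {y | g • y = y} = {y | S.line y = l} := by
    rcases h with h | h
    · exact Set.eq_of_subset_of_ncard_le h hc.ge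
    · exact (Set.eq_of_subset_of_ncard_le h hc.le).symm
  exact Set.ext_iff.1 this y

theorem fixes_fibre_of_unique {g : G} {a : X} (ha : g • a = a)
    (h : ∀ l, S.perm g l = l → l = S.line a) (y : X) (hy : S.line y = S.line a) : g • y = y := by
  by_cases hg : g = 1
  · simp [hg]
  · exact (S.fixed_eq_fibre hg ha (.inl fun y hy => h _ (S.perm_fixes_line hy)) y).2 hy

omit [Finite X] in
-- The map `k ↦ k • a` identifies the kernel with the fibre and turns conjugation by `g` into its
-- action there. The right side does not depend on the fibre, so `g` has equally many fixed points
-- in each fibre containing one.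
theorem card_fixed_fibre {g : G} {a : X} (ha : g • a = a) :
    {y | S.line y = S.line a ∧ g • y = y}.ncard = {k | S.perm k = 1 ∧ g * k = k * g}.ncard := by
  symm
  refine Set.ncard_congr (fun k _ => k • a) ?_ ?_ ?_
  · rintro k ⟨hk, hgk⟩
    exact ⟨by simp [S.line_smul, hk], by rw [smul_smul, hgk, mul_smul, ha]⟩
  · rintro k k' ⟨hk, -⟩ ⟨hk', -⟩ h
    exact S.eq_of_smul_eq a (hk.trans hk'.symm) h
  · rintro y ⟨hy, hgy⟩
    obtain ⟨k, hk, rfl⟩ := S.exists_ker_smul a y hy.symm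
    refine ⟨k, ⟨hk, S.eq_of_smul_eq a (by simp [hk]) ?_⟩, rfl⟩
    rw [mul_smul, hgy, mul_smul, ha]

theorem two_mul_card_fixed_fibre {g : G} (hg : g ≠ 1) {a b : X} (ha : g • a = a)
    (hb : g • b = b) (hab : S.line a ≠ S.line b)
    (h : ∀ l, S.perm g l = l → l = S.line a ∨ l = S.line b) :
    2 * {y | S.line y = S.line a ∧ g • y = y}.ncard = Nat.card F - 1 := by
  have hu : {y | g • y = y} = {y | S.line y = S.line a ∧ g • y = y} ∪
      {y | S.line y = S.line b ∧ g • y = y} := by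
    ext y
    simp only [Set.mem_ofPred_eq, Set.mem_union]
    refine ⟨fun hy => ?_, by tauto⟩
    have := h _ (S.perm_fixes_line hy)
    tauto
  rw [← S.card_fixed g a hg ha]
  change _ = {y | g • y = y}.ncard
  rw [hu, Set.ncard_union_eq (Set.disjoint_left.2 fun y hy hy' => hab (hy.1.symm.trans hy'.1)),
    S.card_fixed_fibre ha, S.card_fixed_fibre hb, two_mul]

/-- Lifts of a split torus fixing exactly two lines fix a fibre pointwise as soon as they fix a
point of it. -/
theorem torus_fixes_fibre [Fintype F] (c : Fˣ →* GL (Fin 2) F) {l m : ℙ F (Fin 2 → F)}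
    (hlm : l ≠ m) (hl : ∀ x, linePerm F (c x) l = l)
    (hfix : ∀ x, x ≠ 1 → ∀ n, linePerm F (c x) n = n → n = l ∨ n = m) {a : X}
    (ha : S.line a = l) {g : G} {x : Fˣ} (hg : S.perm g = linePerm F (c x)) (hga : g • a = a)
    (y : X) (hy : S.line y = l) : g • y = y := by
  classical
  choose γ hγ hγa using fun x => S.exists_lift (c x) a ha (hl x)
  let φ : Fˣ →* G := MonoidHom.mk' γ fun x y => S.eq_of_smul_eq a
    (by simp only [hγ, map_mul]) (by rw [mul_smul, hγa, hγa, hγa])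
  have hφ : ∀ x, S.perm (φ x) = linePerm F (c x) := hγ
  have hφa : ∀ x, φ x • a = a := hγa
  clear_value φ
  obtain rfl : g = φ x := S.eq_of_smul_eq a (hg.trans (hφ x).symm) (hga.trans (hφa x).symm)
  by_contra hmove
  -- Fixed points of the generator are fixed by the whole torus, so it suffices to study `τ`.
  obtain ⟨τ, hτ⟩ := IsCyclic.exists_generator (α := Fˣ)
  have hgen : ∀ z : X, φ τ • z = z → ∀ x, φ x • z = z := fun z hz x => by
    obtain ⟨n, rfl⟩ := Subgroup.mem_zpowers_iff.1 (hτ x)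
    rw [map_zpow]
    exact MulAction.mem_stabilizer_iff.1
      ((MulAction.stabilizer G z).zpow_mem (MulAction.mem_stabilizer_iff.2 hz) n)
  have hτy : φ τ • y ≠ y := fun h => hmove (hgen y h x)
  have hτ1 : φ τ ≠ 1 := fun h => hτy (by rw [h, one_smul])
  have h1 : ∀ x, φ x ≠ 1 → x ≠ 1 := fun x hx h => hx (by rw [h, map_one])
  -- If all `q - 1` fixed points of `φ τ` lay over `l`, they would fill that fibre, including `y`.
  obtain ⟨b, hb, hbl⟩ : ∃ b, φ τ • b = b ∧ S.line b ≠ l := by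
    by_contra! h
    exact hτy ((S.fixed_eq_fibre hτ1 (hφa τ) (.inl h) y).2 hy)
  have hbm : S.line b = m :=
    (hfix τ (h1 _ hτ1) _ (by rw [← hφ]; exact S.perm_fixes_line hb)).resolve_left hbl
  have hcard : ∀ x, φ x ≠ 1 →
      2 * {y | S.line y = l ∧ φ x • y = y}.ncard = Nat.card F - 1 := fun x hx => by
    rw [← ha]
    refine S.two_mul_card_fixed_fibre hx (hφa x) (hgen b hb x) (by rwa [ha, hbm]) fun n hn => ?_
    rw [ha, hbm]
    exact hfix x (h1 x hx) n (by rw [← hφ, hn])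
  -- Every nontrivial `φ x` has exactly (q - 1)/2 fixed points over `l`, so these are just those of
  -- `φ τ`, and `y` is not among them.
  have hmoves : ∀ x, φ x ≠ 1 → φ x • y ≠ y := fun x hx hxy => by
    have hsub : {y | S.line y = l ∧ φ τ • y = y} ⊆ {y | S.line y = l ∧ φ x • y = y} :=
      fun z hz => ⟨hz.1, hgen z hz.2 x⟩
    have := Set.eq_of_subset_of_ncard_le hsub (by have := hcard x hx; have := hcard τ hτ1; omega)
    exact hτy ((Set.ext_iff.1 this y).2 ⟨hy, hxy⟩).2
  have hinj : Function.Injective φ := (injective_iff_map_eq_one φ).2 fun x hx => by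
    by_contra hx1
    have h2 := hφ x
    rw [hx, map_one] at h2
    obtain ⟨n, hn⟩ : ∃ n, n ∉ ({l, m} : Set (ℙ F (Fin 2 → F))) := by
      by_contra! hall
      have h3 := Set.ncard_le_ncard (s := Set.univ) (t := {l, m}) (fun n _ => hall n)
      rw [Set.ncard_univ, card_lines, Set.ncard_pair hlm] at h3
      have := Fintype.one_lt_card (α := F)
      omega
    exact hn (hfix x hx1 n (by rw [← h2, Equiv.Perm.one_apply]))
  -- The torus orbit of `y` has `q - 1` elements but avoids the fixed point `a` in a fibre of size
  -- `q - 1`: a contradiction.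
  have hle := Set.ncard_le_ncard (s := Set.range fun x => φ x • y)
    (t := {y | S.line y = l} \ {a}) (by
      rintro _ ⟨x, rfl⟩
      refine ⟨?_, fun h => ?_⟩
      · change S.line (φ x • y) = l
        rw [S.line_smul, hφ, hy, hl]
      · have h : φ x • y = a := h
        rw [smul_eq_iff_eq_inv_smul, ← map_inv, hφa] at h
        exact hτy (by rw [h, hφa]))
  have hinj' : Function.Injective fun x => φ x • y := fun s t (h : φ s • y = φ t • y) => by
    by_contra hst
    refine hmoves (t⁻¹ * s) (fun h1 => hst ?_) ?_
    · exact (inv_mul_eq_one.1 (hinj (h1.trans φ.map_one.symm))).symm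
    · rw [map_mul, mul_smul, h, map_inv, inv_smul_smul]
  rw [Set.ncard_range_of_injective hinj', Set.ncard_sdiff_singleton_of_mem (by exact ha)] at hle
  have h4 : {y | S.line y = l}.ncard = Nat.card F - 1 := S.card_fibre l
  rw [h4, Nat.card_eq_fintype_card, Nat.card_eq_fintype_card, Fintype.card_units] at hle
  have := Fintype.one_lt_card (α := F)
  omega

theorem diagGL_fixes_fibre_lineInf [Fintype F] {a : X} (ha : S.line a = lineInf F) {g : G}
    {y : Fˣ} (hg : S.perm g = linePerm F (diagGL 1 y)) (hga : g • a = a) (z : X)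
    (hz : S.line z = lineInf F) : g • z = z := by
  refine S.torus_fixes_fibre
    (MonoidHom.mk' (fun y => diagGL 1 y) fun x y => by rw [diagGL_mul, one_mul])
    (lineAt_ne_lineInf 0).symm (fun x => linePerm_diagGL_lineInf _ _)
    (fun x hx n hn => ?_) ha hg hga z hz
  rcases eq_lineInf_or_lineAt n with rfl | ⟨s, rfl⟩
  · exact .inl rfl
  · replace hn : linePerm F (diagGL 1 x) (lineAt s) = lineAt s := hn
    rw [linePerm_diagGL_lineAt] at hn
    have := lineAt_injective hn
    by_cases hs : s = 0
    · simp [hs]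
    · refine absurd ?_ hx
      ext
      field_simp at this
      simpa [hs] using this.symm

theorem diagGL_fixes_fibre_lineAt_zero [Fintype F] {b : X} (hb : S.line b = lineAt 0) {g : G}
    {x : Fˣ} (hg : S.perm g = linePerm F (diagGL x 1)) (hgb : g • b = b) (z : X)
    (hz : S.line z = lineAt 0) : g • z = z := by
  refine S.torus_fixes_fibre
    (MonoidHom.mk' (fun x => diagGL x 1) fun x y => by rw [diagGL_mul, one_mul])
    (lineAt_ne_lineInf 0) (fun x => by simp [linePerm_diagGL_lineAt])
    (fun x hx n hn => ?_) hb hg hgb z hz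
  rcases eq_lineInf_or_lineAt n with rfl | ⟨s, rfl⟩
  · exact .inr rfl
  · replace hn : linePerm F (diagGL x 1) (lineAt s) = lineAt s := hn
    rw [linePerm_diagGL_lineAt] at hn
    have := lineAt_injective hn
    by_cases hs : s = 0
    · simp [hs]
    · refine absurd ?_ hx
      ext
      field_simp at this
      simpa [hs] using this

theorem unipGL_fixes_fibre {a : X} (ha : S.line a = lineInf F) {g : G}
    {s : F} (hg : S.perm g = linePerm F (unipGL s)) (hga : g • a = a) (z : X)
    (hz : S.line z = lineInf F) : g • z = z := by
  by_cases hs : s = 0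
  · have h1 : unipGL (0 : F) = 1 := by
      ext i j
      fin_cases i <;> fin_cases j <;> simp [coe_unipGL]
    rw [hs, h1, map_one] at hg
    rw [S.eq_one_of_smul g a hg hga, one_smul]
  · refine S.fixes_fibre_of_unique hga (fun n hn => ?_) z (hz.trans ha.symm)
    rcases eq_lineInf_or_lineAt n with rfl | ⟨t, rfl⟩
    · exact ha.symm
    · rw [hg, linePerm_unipGL_lineAt] at hn
      exact absurd (by simpa using lineAt_injective hn) hs

end Finite

/-- Elements of the group acting on lines like the elementary matrices, and two base points, such
that these elements satisfy the relations of the elementary matrices. -/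
structure Frame where
  /-- Scalar matrices. -/
  z : Fˣ →* G
  /-- Diagonal matrices with first entry `1`. -/
  α : Fˣ → G
  /-- Diagonal matrices with second entry `1`. -/
  β : Fˣ → G
  /-- Upper unitriangular matrices. -/
  u : F → G
  /-- The exchange of the coordinates. -/
  w : G
  /-- The first basis vector. -/
  a : X
  /-- The second basis vector. -/
  b : X
  line_a : S.line a = lineInf F
  line_b : S.line b = lineAt 0
  perm_z : ∀ x, S.perm (z x) = 1
  perm_u : ∀ s, S.perm (u s) = linePerm F (unipGL s)
  z_injective : Function.Injective z
  exists_z : ∀ k, S.perm k = 1 → ∃ x, k = z x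
  α_z : ∀ x y, α x * z y = z y * α x
  β_z : ∀ x y, β x * z y = z y * β x
  u_z : ∀ s y, u s * z y = z y * u s
  w_z : ∀ y, w * z y = z y * w
  α_u : ∀ (x : Fˣ) (s : F), α x * u s = u (s / x) * α x
  β_u : ∀ (x : Fˣ) (s : F), β x * u s = u (x * s) * β x
  u_u : ∀ s t, u s * u t = u (s + t)
  α_a : ∀ x, α x • a = a
  β_a : ∀ x, β x • a = z x • a
  u_a : ∀ s, u s • a = a
  α_b : ∀ x, α x • b = z x • b
  β_b : ∀ x, β x • b = b
  w_a : w • a = b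
  w_b : w • b = a
  w_u_b : ∀ s : Fˣ, w • u s • b = z s • u (s : F)⁻¹ • b

/-- Lifts fixing a base point are rigid enough to satisfy the matrix relations. Only the lift `w` of
the exchange is free up to the kernel, and it is corrected by a scalar at the end. -/
theorem exists_frame [Finite X] [Fintype F] : Nonempty S.Frame := by
  obtain ⟨a, ha⟩ := S.line_surjective (lineInf F)
  obtain ⟨w, hw⟩ := S.exists_perm_eq (swapGL F)
  obtain ⟨b, hb⟩ : ∃ b, b = w • a := ⟨_, rfl⟩
  have hlb : S.line b = lineAt 0 := by rw [hb, S.line_smul, hw, ha, linePerm_swapGL_lineInf]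
  choose α hα hαa using fun y =>
    S.exists_lift (diagGL 1 y) a ha (linePerm_diagGL_lineInf 1 y)
  choose β hβ hβb using fun x =>
    S.exists_lift (diagGL x 1) b hlb (by simp [linePerm_diagGL_lineAt])
  choose u hu hua using fun s =>
    S.exists_lift (unipGL s) a ha (linePerm_unipGL_lineInf s)
  have fα := fun y => S.diagGL_fixes_fibre_lineInf ha (hα y) (hαa y)
  have fβ := fun x => S.diagGL_fixes_fibre_lineAt_zero hlb (hβ x) (hβb x)
  have fu := fun s => S.unipGL_fixes_fibre ha (hu s) (hua s)
  have αk : ∀ y k, S.perm k = 1 → α y * k = k * α y :=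
    fun y k hk => S.commute_of_fixes_fibre (fα y) hk
  have βk : ∀ x k, S.perm k = 1 → β x * k = k * β x :=
    fun x k hk => S.commute_of_fixes_fibre (fβ x) hk
  have uk : ∀ s k, S.perm k = 1 → u s * k = k * u s :=
    fun s k hk => S.commute_of_fixes_fibre (fu s) hk
  have αα : ∀ x y, α (x * y) = α x * α y := fun x y => S.eq_of_smul_eq a
    (by rw [map_mul, hα, hα, hα, ← map_mul, diagGL_mul, one_mul])
    (by rw [mul_smul, hαa, hαa, hαa])
  have ββ : ∀ x y, β (x * y) = β x * β y := fun x y => S.eq_of_smul_eq b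
    (by rw [map_mul, hβ, hβ, hβ, ← map_mul, diagGL_mul, one_mul])
    (by rw [mul_smul, hβb, hβb, hβb])
  have hz : ∀ x, S.perm (α x * β x) = 1 := fun x => by
    rw [map_mul, hα, hβ, ← map_mul, diagGL_mul, one_mul, mul_one]
    exact linePerm_eq_one_iff.2 ⟨x, rfl⟩
  -- Multiplicativity needs no commutation of `α` with `β`: the product `α x * β x` is in the
  -- kernel, which `α y` centralizes.
  let z : Fˣ →* G := MonoidHom.mk' (fun x => α x * β x) fun x y => by
    calc α (x * y) * β (x * y) = α y * (α x * β x) * β y := by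
          rw [mul_comm x y, αα, mul_comm y x, ββ]
          simp only [mul_assoc]
      _ = α x * β x * (α y * β y) := by
          rw [αk y _ (hz x)]
          simp only [mul_assoc]
  have z_eq : ∀ x, z x = α x * β x := fun x => rfl
  replace hz : ∀ x, S.perm (z x) = 1 := hz
  clear_value z
  have βα : ∀ x, β x * α x = z x := fun x => by
    have h := αk x (z x) (hz x)
    rw [z_eq, mul_assoc] at h
    rw [← mul_left_cancel h, z_eq]
  -- If `z x = 1`, then `α x` fixes `b`. A nontrivial `α x` fixes only the fibre over `lineInf`, and
  -- `b` lies elsewhere.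
  have zinj : Function.Injective z := (injective_iff_map_eq_one z).2 fun x hx => by
    have h1 : α x • b = b := by
      rw [z_eq] at hx
      nth_rewrite 1 [← hβb x]
      rw [smul_smul, hx, one_smul]
    by_contra hx1
    have h2 : α x ≠ 1 := fun h => by
      have h3 := hα x
      rw [h, map_one] at h3
      obtain ⟨y, hy⟩ := linePerm_eq_one_iff.1 h3.symm
      have e0 := congrArg (fun A : GL (Fin 2) F => A 0 0) hy
      have e1 := congrArg (fun A : GL (Fin 2) F => A 1 1) hy
      simp [coe_diagGL] at e0 e1
      exact hx1 (Units.ext (by rw [e1, ← e0, Units.val_one]))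
    have h3 := (S.fixed_eq_fibre h2 (hαa x) (.inr (fα x)) b).1 h1
    exact lineAt_ne_lineInf 0 (hlb.symm.trans h3)
  have zsurj : ∀ k, S.perm k = 1 → ∃ x, k = z x := by
    let f : Fˣ → S.perm.ker := fun x => ⟨z x, hz x⟩
    have hfin : Finite S.perm.ker := by
      refine Nat.finite_of_card_ne_zero ?_
      rw [S.card_ker, Nat.card_eq_fintype_card]
      have := Fintype.one_lt_card (α := F)
      omega
    have hf := (Nat.bijective_iff_injective_and_card f).2
      ⟨fun x y h => zinj (congrArg Subtype.val h), by
        classical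
        rw [S.card_ker, Nat.card_eq_fintype_card, Nat.card_eq_fintype_card, Fintype.card_units]⟩
    intro k hk
    obtain ⟨x, hx⟩ := hf.2 ⟨k, hk⟩
    exact ⟨x, (congrArg Subtype.val hx).symm⟩
  have αz := fun x y => αk x (z y) (hz y)
  have βz := fun x y => βk x (z y) (hz y)
  have uz := fun s y => uk s (z y) (hz y)
  have wα : ∀ x, w * α x = β x * w := fun x => S.eq_of_smul_eq a
    (by rw [map_mul, map_mul, hα, hβ, hw, ← map_mul, ← map_mul, swapGL_mul_diagGL])
    (by rw [mul_smul, mul_smul, hαa, ← hb, hβb])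
  have wβ : ∀ x, w * β x = α x * w := fun x => S.eq_of_smul_eq b
    (by rw [map_mul, map_mul, hα, hβ, hw, ← map_mul, ← map_mul, swapGL_mul_diagGL])
    (by rw [mul_smul, mul_smul, hβb, fα x (w • b) (by
      rw [S.line_smul, hw, hlb, linePerm_swapGL_lineAt_zero])])
  have wz : ∀ x, w * z x = z x * w := fun x => by
    rw [z_eq, ← mul_assoc, wα, mul_assoc, wβ, ← mul_assoc, βα, z_eq]
  have αu : ∀ (x : Fˣ) (s : F), α x * u s = u (s / x) * α x := fun x s => S.eq_of_smul_eq a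
    (by rw [map_mul, map_mul, hα, hu, hu, ← map_mul, ← map_mul, diagGL_mul_unipGL, Units.val_one,
      one_mul])
    (by rw [mul_smul, mul_smul, hαa, hua, hua, hαa])
  have βu : ∀ (x : Fˣ) (s : F), β x * u s = u (x * s) * β x := fun x s => S.eq_of_smul_eq a
    (by rw [map_mul, map_mul, hβ, hu, hu, ← map_mul, ← map_mul, diagGL_mul_unipGL, Units.val_one,
      div_one])
    (by rw [mul_smul, mul_smul, hua, fu _ (β x • a) (by
      rw [S.line_smul, hβ, ha, linePerm_diagGL_lineInf])])
  have uu : ∀ s t, u s * u t = u (s + t) := fun s t => S.eq_of_smul_eq a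
    (by rw [map_mul, hu, hu, hu, ← map_mul, unipGL_mul])
    (by rw [mul_smul, hua, hua, hua])
  have line_ub : ∀ s, S.line (u s • b) = lineAt s := fun s => by
    rw [S.line_smul, hu, hlb, linePerm_unipGL_lineAt, add_zero]
  -- The exchange fixes the line of (1, 1), so `w` moves `u 1 • b` by a scalar `f`; this is the only
  -- discrepancy to remove.
  obtain ⟨k, hk, hkb⟩ := S.exists_ker_smul (u 1 • b) (w • u 1 • b) (by
    rw [S.line_smul w, hw, line_ub, linePerm_swapGL_lineAt one_ne_zero, inv_one])
  obtain ⟨f, rfl⟩ := zsurj k hk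
  have αb : ∀ x c, S.line c = lineAt 0 → α x • c = z x • c := fun x c hc => by
    rw [z_eq, mul_smul, fβ x c hc]
  have hwub : ∀ s : Fˣ, w • u s • b = z s • z f • u (s : F)⁻¹ • b := fun s => by
    -- In matrices: diag(1, 1/s) sends (1, 1) to (1/s)(s, 1). Applying `w` transports the relation
    -- from `s = 1` to every `s`.
    have h1 : α s⁻¹ • u 1 • b = z s⁻¹ • u s • b := by
      rw [smul_smul, αu, mul_smul, αb _ _ hlb, smul_smul, uz, mul_smul]
      simp
    have h2 := congrArg (fun c => w • c) h1
    rw [smul_smul, wα, mul_smul, ← hkb, smul_smul, βz, mul_smul, smul_smul (β s⁻¹), βu, mul_smul,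
      hβb, smul_smul w, wz, mul_smul, map_inv, ← smul_eq_iff_eq_inv_smul] at h2
    rw [← h2]
    simp
  have hzcomm : ∀ x y, z x * z y = z y * z x := fun x y => by
    rw [← map_mul, mul_comm, map_mul]
  -- Rescaling `b` along with `w` keeps `w' • a = b'` while cancelling `f`.
  let w' := z f⁻¹ * w
  let b' := z f⁻¹ • b
  have hw' : S.perm w' = linePerm F (swapGL F) := by simp [w', hz, hw]
  have hlb' : S.line b' = lineAt 0 := by
    simp [b', S.line_smul, hlb, hz, -map_inv]
  have hwub' : ∀ s : Fˣ, w' • u s • b' = z s • u (s : F)⁻¹ • b' := fun s => by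
    simp only [w', b']
    rw [smul_smul (u s), uz, mul_smul, mul_smul, smul_smul w, wz, mul_smul, hwub,
      smul_smul (u _), uz]
    simp only [smul_smul, ← mul_assoc, ← map_mul]
    congr 3
    rw [mul_right_comm, inv_mul_cancel_right, mul_comm]
  -- After the correction `w'` fixes `u 1 • b'`, so its square is a kernel element with a fixed
  -- point.
  have hww : w' * w' = 1 := by
    refine S.eq_one_of_smul _ (u 1 • b') ?_ ?_
    · rw [map_mul, hw', ← map_mul, swapGL_mul_swapGL, map_one]
    · have := hwub' 1
      simp only [Units.val_one, inv_one, map_one, one_smul] at this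
      rw [mul_smul, this, this]
  have hwa' : w' • a = b' := by simp only [w', b', mul_smul, hb]
  exact ⟨{
    z := z
    α := α
    β := β
    u := u
    w := w'
    a := a
    b := b'
    line_a := ha
    line_b := hlb'
    perm_z := hz
    perm_u := hu
    z_injective := zinj
    exists_z := zsurj
    α_z := αz
    β_z := βz
    u_z := uz
    w_z := fun y => by rw [mul_assoc, wz, ← mul_assoc, hzcomm, mul_assoc]
    α_u := αu
    β_u := βu
    u_u := uu
    α_a := hαa
    β_a := fun x => by rw [← βα, mul_smul, hαa]
    u_a := hua
    α_b := fun x => αb x b' hlb'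
    β_b := fun x => fβ x b' hlb'
    w_a := hwa'
    w_b := by rw [← hwa', smul_smul, hww, one_smul]
    w_u_b := hwub' }⟩

end PlaneAction

/-! ### Coordinates from a frame, and the action by matrices. -/

namespace PlaneAction.Frame

variable {F G X : Type*} [Field F] [Group G] [MulAction G X] {S : PlaneAction F G X}
  (R : S.Frame)

open scoped Classical in
/-- The point with given coordinates. -/
noncomputable def point (v : {v : Fin 2 → F // v ≠ 0}) : X :=
  if h : v.1 1 = 0 then
    R.z (Units.mk0 (v.1 0) fun h0 => v.2 (by ext i; fin_cases i <;> simp [h0, h])) • R.a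
  else R.u (v.1 0 / v.1 1) • R.z (Units.mk0 (v.1 1) h) • R.b

theorem point_of_eq_zero (x : Fˣ) (v : {v : Fin 2 → F // v ≠ 0}) (h0 : v.1 0 = x)
    (h1 : v.1 1 = 0) : R.point v = R.z x • R.a := by
  rw [point, dif_pos h1]
  congr 2
  ext
  simpa using h0

theorem point_of_ne_zero (s : F) (y : Fˣ) (v : {v : Fin 2 → F // v ≠ 0}) (h0 : v.1 0 = s * y)
    (h1 : v.1 1 = y) : R.point v = R.u s • R.z y • R.b := by
  have h : v.1 1 ≠ 0 := by simp [h1]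
  rw [point, dif_neg h]
  congr 3
  · simp [h0, h1]
  · ext
    simpa using h1

theorem coordinates_cases (v : {v : Fin 2 → F // v ≠ 0}) :
    (∃ x : Fˣ, v.1 0 = x ∧ v.1 1 = 0) ∨ ∃ (s : F) (y : Fˣ), v.1 0 = s * y ∧ v.1 1 = y := by
  by_cases h : v.1 1 = 0
  · have h0 : v.1 0 ≠ 0 := fun h0 => v.2 (by ext i; fin_cases i <;> simp [h0, h])
    exact .inl ⟨Units.mk0 _ h0, rfl, h⟩
  · exact .inr ⟨v.1 0 / v.1 1, Units.mk0 _ h, by simp [h], rfl⟩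

theorem line_point (v : {v : Fin 2 → F // v ≠ 0}) : S.line (R.point v) = lineOf v.1 v.2 := by
  rcases coordinates_cases v with ⟨x, h0, h1⟩ | ⟨s, y, h0, h1⟩
  · rw [R.point_of_eq_zero x v h0 h1, S.line_smul, R.perm_z, R.line_a, lineOf_eq_lineInf v.2 h1]
    rfl
  · rw [R.point_of_ne_zero s y v h0 h1, S.line_smul, S.line_smul, R.perm_z, R.perm_u, R.line_b,
      Equiv.Perm.one_apply, linePerm_unipGL_lineAt, lineOf_eq_lineAt v.2 (by simp [h1]), h0, h1]
    simp

theorem point_injective : Function.Injective R.point := fun v v' h => by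
  have hl : lineOf v.1 v.2 = lineOf v'.1 v'.2 := by rw [← R.line_point, ← R.line_point, h]
  rw [lineOf_eq_lineOf_iff] at hl
  have hz : ∀ {x x' : Fˣ} {c : X}, R.z x • c = R.z x' • c → x = x' := fun h =>
    R.z_injective (S.eq_of_smul_eq _ (by rw [R.perm_z, R.perm_z]) h)
  rcases coordinates_cases v with ⟨x, h0, h1⟩ | ⟨s, y, h0, h1⟩ <;>
  rcases coordinates_cases v' with ⟨x', h0', h1'⟩ | ⟨s', y', h0', h1'⟩ <;>
  rw [h0, h1, h0', h1'] at hl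
  · rw [R.point_of_eq_zero x v h0 h1, R.point_of_eq_zero x' v' h0' h1'] at h
    have := hz h
    subst this
    ext i
    fin_cases i <;> simp [h0, h1, h0', h1']
  · simp at hl
  · simp at hl
  · have hs : s = s' := by
      have : s * y * y' = s' * y * y' := by linear_combination hl
      simpa using this
    subst hs
    rw [R.point_of_ne_zero s y v h0 h1, R.point_of_ne_zero s y' v' h0' h1'] at h
    have := hz (MulAction.injective _ h)
    subst this
    ext i
    fin_cases i <;> simp [h0, h1, h0', h1']

theorem point_surjective : Function.Surjective R.point := fun c => by
  rcases eq_lineInf_or_lineAt (S.line c) with hc | ⟨s, hc⟩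
  · obtain ⟨k, hk, rfl⟩ := S.exists_ker_smul R.a c (R.line_a.trans hc.symm)
    obtain ⟨x, rfl⟩ := R.exists_z k hk
    exact ⟨⟨![x, 0], fun h => by simpa using congrFun h 0⟩, R.point_of_eq_zero x _ rfl rfl⟩
  · obtain ⟨k, hk, rfl⟩ := S.exists_ker_smul (R.u s • R.b) c (by
      rw [hc, S.line_smul, R.perm_u, R.line_b, linePerm_unipGL_lineAt, add_zero])
    obtain ⟨y, rfl⟩ := R.exists_z k hk
    refine ⟨⟨![s * y, y], fun h => by simpa using congrFun h 1⟩, ?_⟩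
    rw [R.point_of_ne_zero s y _ rfl rfl, smul_smul, R.u_z, mul_smul]

/-- The element `g` acts by the matrix `A` in the coordinates of the frame. -/
def ActsAs (g : G) (A : GL (Fin 2) F) : Prop :=
  ∀ v : {v : Fin 2 → F // v ≠ 0}, g • R.point v =
    R.point ⟨(A : Matrix (Fin 2) (Fin 2) F).mulVec v.1, GL_mulVec_ne_zero A v.2⟩

variable {R}

theorem ActsAs.mul {g h : G} {A B : GL (Fin 2) F} (hg : R.ActsAs g A) (hh : R.ActsAs h B) :
    R.ActsAs (g * h) (A * B) := fun v => by
  rw [mul_smul, hh, hg]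
  exact congrArg R.point (Subtype.ext (Matrix.mulVec_mulVec v.1 A.val B.val))

theorem ActsAs.eq_right {g : G} {A B : GL (Fin 2) F} (hA : R.ActsAs g A) (hB : R.ActsAs g B) :
    A = B := by
  refine Units.ext (Matrix.ext_of_mulVec_single fun i => ?_)
  have h := R.point_injective ((hA ⟨Pi.single i 1, by simp⟩).symm.trans (hB _))
  exact congrArg Subtype.val h

theorem ActsAs.eq_left [FaithfulSMul G X] {g h : G} {A : GL (Fin 2) F} (hg : R.ActsAs g A)
    (hh : R.ActsAs h A) : g = h :=
  FaithfulSMul.eq_of_smul_eq_smul (α := X) fun c => by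
    obtain ⟨v, rfl⟩ := R.point_surjective c
    rw [hg, hh]

theorem ActsAs.perm_eq {g : G} {A : GL (Fin 2) F} (hg : R.ActsAs g A) :
    S.perm g = linePerm F A := by
  ext l
  induction l using Projectivization.ind with | h v hv =>
  have h := congrArg S.line (hg ⟨v, hv⟩)
  rw [S.line_smul, R.line_point, R.line_point] at h
  rw [h, linePerm_lineOf]

variable (R)

theorem actsAs_u (s : F) : R.ActsAs (R.u s) (unipGL s) := fun v => by
  rcases coordinates_cases v with ⟨x, h0, h1⟩ | ⟨t, y, h0, h1⟩
  · rw [R.point_of_eq_zero x v h0 h1, R.point_of_eq_zero x, smul_smul, R.u_z, mul_smul, R.u_a]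
    · simp [coe_unipGL, Matrix.vecHead, Matrix.vecTail, h0, h1]
    · simp [coe_unipGL, Matrix.vecHead, Matrix.vecTail, h1]
  · rw [R.point_of_ne_zero t y v h0 h1, R.point_of_ne_zero (s + t) y, smul_smul, R.u_u]
    · simp [coe_unipGL, Matrix.vecHead, Matrix.vecTail, h0, h1]
      ring
    · simp [coe_unipGL, Matrix.vecHead, Matrix.vecTail, h1]

theorem actsAs_α (r : Fˣ) : R.ActsAs (R.α r) (diagGL 1 r) := fun v => by
  rcases coordinates_cases v with ⟨x, h0, h1⟩ | ⟨t, y, h0, h1⟩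
  · rw [R.point_of_eq_zero x v h0 h1, R.point_of_eq_zero x, smul_smul, R.α_z, mul_smul, R.α_a]
    · simp [coe_diagGL, Matrix.vecHead, Matrix.vecTail, h0]
    · simp [coe_diagGL, Matrix.vecHead, Matrix.vecTail, h1]
  · rw [R.point_of_ne_zero t y v h0 h1, R.point_of_ne_zero (t / r) (y * r), smul_smul, R.α_u,
      mul_smul, smul_smul (R.α r), R.α_z, mul_smul, R.α_b, map_mul, mul_smul]
    · simp [coe_diagGL, Matrix.vecHead, Matrix.vecTail, h0]
      field_simp
    · simp [coe_diagGL, Matrix.vecHead, Matrix.vecTail, h1, mul_comm]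

theorem actsAs_β (r : Fˣ) : R.ActsAs (R.β r) (diagGL r 1) := fun v => by
  rcases coordinates_cases v with ⟨x, h0, h1⟩ | ⟨t, y, h0, h1⟩
  · rw [R.point_of_eq_zero x v h0 h1, R.point_of_eq_zero (x * r), smul_smul, R.β_z, mul_smul,
      R.β_a, map_mul, mul_smul]
    · simp [coe_diagGL, Matrix.vecHead, Matrix.vecTail, h0, mul_comm]
    · simp [coe_diagGL, Matrix.vecHead, Matrix.vecTail, h1]
  · rw [R.point_of_ne_zero t y v h0 h1, R.point_of_ne_zero (r * t) y, smul_smul, R.β_u,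
      mul_smul, smul_smul (R.β r), R.β_z, mul_smul, R.β_b]
    · simp [coe_diagGL, Matrix.vecHead, Matrix.vecTail, h0, mul_assoc]
    · simp [coe_diagGL, Matrix.vecHead, Matrix.vecTail, h1]

theorem u_zero : R.u 0 = 1 := by
  have := R.u_u 0 0
  rwa [add_zero, mul_eq_left] at this

/-- Off the axes this is `w_u_b`: the exchange sends (s, 1) to s(1/s, 1). -/
theorem actsAs_w : R.ActsAs R.w (swapGL F) := fun v => by
  rcases coordinates_cases v with ⟨x, h0, h1⟩ | ⟨t, y, h0, h1⟩
  · rw [R.point_of_eq_zero x v h0 h1, R.point_of_ne_zero 0 x, smul_smul, R.w_z, mul_smul, R.w_a,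
      R.u_zero, one_smul]
    · simp [coe_swapGL, Matrix.vecHead, Matrix.vecTail, h1]
    · simp [coe_swapGL, Matrix.vecHead, Matrix.vecTail, h0]
  · rw [R.point_of_ne_zero t y v h0 h1]
    by_cases ht : t = 0
    · subst ht
      rw [R.point_of_eq_zero y, R.u_zero, one_smul, smul_smul, R.w_z, mul_smul, R.w_b]
      · simp [coe_swapGL, Matrix.vecHead, Matrix.vecTail, h1]
      · simp [coe_swapGL, Matrix.vecHead, Matrix.vecTail, h0]
    · lift t to Fˣ using isUnit_iff_ne_zero.2 ht
      rw [R.point_of_ne_zero (t : F)⁻¹ (t * y), smul_smul (R.u t), R.u_z, mul_smul, smul_smul R.w,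
        R.w_z, mul_smul, R.w_u_b, smul_smul (R.u _), R.u_z, mul_smul, smul_smul, ← map_mul,
        mul_comm y t]
      · simp [coe_swapGL, Matrix.vecHead, Matrix.vecTail, h1]
      · simp [coe_swapGL, Matrix.vecHead, Matrix.vecTail, h0]

theorem actsAs_z (r : Fˣ) : R.ActsAs (R.z r) (diagGL r r) := fun v => by
  rcases coordinates_cases v with ⟨x, h0, h1⟩ | ⟨t, y, h0, h1⟩
  · rw [R.point_of_eq_zero x v h0 h1, R.point_of_eq_zero (r * x), smul_smul, map_mul]
    · simp [coe_diagGL, Matrix.vecHead, Matrix.vecTail, h0]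
    · simp [coe_diagGL, Matrix.vecHead, Matrix.vecTail, h1]
  · rw [R.point_of_ne_zero t y v h0 h1, R.point_of_ne_zero t (r * y), map_mul, mul_smul,
      smul_smul (R.z r), ← R.u_z, mul_smul]
    · simp [coe_diagGL, Matrix.vecHead, Matrix.vecTail, h0]
      ring
    · simp [coe_diagGL, Matrix.vecHead, Matrix.vecTail, h1]

/-- Every matrix is realized by an element of the group. -/
theorem exists_actsAs (A : GL (Fin 2) F) : ∃ g, R.ActsAs g A := by
  suffices h : ∀ M : Matrix (Fin 2) (Fin 2) F, M.det ≠ 0 →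
      ∀ B : GL (Fin 2) F, (B : Matrix (Fin 2) (Fin 2) F) = M → ∃ g, R.ActsAs g B from
    h _ A.det_ne_zero A rfl
  intro M hM
  refine Matrix.diagonal_transvection_induction_of_det_ne_zero
    (fun M => ∀ B : GL (Fin 2) F, (B : Matrix (Fin 2) (Fin 2) F) = M → ∃ g, R.ActsAs g B) M hM
    ?_ ?_ ?_
  · intro D hD B hB
    rw [Matrix.det_diagonal, Fin.prod_univ_two] at hD
    have : B = diagGL (.mk0 _ (left_ne_zero_of_mul hD)) 1 *
        diagGL 1 (.mk0 _ (right_ne_zero_of_mul hD)) := by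
      rw [diagGL_mul]
      ext i j
      rw [hB]
      fin_cases i <;> fin_cases j <;> simp [coe_diagGL]
    rw [this]
    exact ⟨_, (R.actsAs_β _).mul (R.actsAs_α _)⟩
  · rintro ⟨i, j, hij, c⟩ B hB
    by_cases hi : i = 0
    · have : B = unipGL c := by
        ext k l
        rw [hB]
        fin_cases i <;> fin_cases j <;> fin_cases k <;> fin_cases l <;>
          first | exact absurd rfl hij | simp_all [coe_unipGL, Matrix.TransvectionStruct.toMatrix, Matrix.transvection]
      rw [this]
      exact ⟨_, R.actsAs_u c⟩
    -- A lower transvection is the upper one conjugated by the exchange.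
    · have : B = swapGL F * unipGL c * swapGL F := by
        ext k l
        rw [hB]
        fin_cases i <;> fin_cases j <;> fin_cases k <;> fin_cases l <;>
          first | exact absurd rfl hij | simp_all [coe_unipGL, coe_swapGL, Matrix.TransvectionStruct.toMatrix,
            Matrix.transvection]
      rw [this]
      exact ⟨_, (R.actsAs_w.mul (R.actsAs_u c)).mul R.actsAs_w⟩
  · intro A B hA hB hA' hB' C hC
    obtain ⟨g, hg⟩ := hA' (.mkOfDetNeZero A hA) rfl
    obtain ⟨h, hh⟩ := hB' (.mkOfDetNeZero B hB) rfl
    refine ⟨g * h, ?_⟩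
    have : C = .mkOfDetNeZero A hA * .mkOfDetNeZero B hB := Units.ext hC
    rw [this]
    exact hg.mul hh

/-- Every element of the group acts by a matrix. -/
theorem exists_matrix_actsAs (g : G) : ∃ A, R.ActsAs g A := by
  obtain ⟨A, hA⟩ := S.range_perm.le ⟨g, rfl⟩
  obtain ⟨h, hh⟩ := R.exists_actsAs A
  -- `g` and a realization `h` of `A` agree on lines, so they differ by a scalar.
  obtain ⟨x, hx⟩ := R.exists_z (g * h⁻¹) (by rw [map_mul, map_inv, hh.perm_eq, hA, mul_inv_cancel])
  refine ⟨diagGL x x * A, ?_⟩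
  have := (R.actsAs_z x).mul hh
  rwa [← hx, inv_mul_cancel_right] at this

theorem exists_mulEquiv (R : S.Frame) [FaithfulSMul G X] :
    ∃ (e : G ≃* GL (Fin 2) F) (x : X ≃ {v : Fin 2 → F // v ≠ 0}), ∀ (g : G) (a : X),
      (x (g • a) : Fin 2 → F) = Matrix.mulVec (e g : Matrix (Fin 2) (Fin 2) F) (x a) := by
  choose M hM using R.exists_matrix_actsAs
  let x : {v : Fin 2 → F // v ≠ 0} ≃ X :=
    Equiv.ofBijective R.point ⟨R.point_injective, R.point_surjective⟩
  refine ⟨MulEquiv.ofBijective (MonoidHom.mk' M fun g h => (hM (g * h)).eq_right ((hM g).mul (hM h)))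
    ⟨fun g h hgh => ?_, fun A => ?_⟩, x.symm, fun g a => ?_⟩
  · have hgh : M g = M h := hgh
    exact (hM g).eq_left (hgh ▸ hM h)
  · obtain ⟨g, hg⟩ := R.exists_actsAs A
    exact ⟨g, (hM g).eq_right hg⟩
  · obtain ⟨v, rfl⟩ := x.surjective a
    have h : g • x v = x ⟨_, GL_mulVec_ne_zero (M g) v.2⟩ := hM g v
    rw [h, Equiv.symm_apply_apply, Equiv.symm_apply_apply]
    rfl

end PlaneAction.Frame

/-! ### Assembly. -/

theorem mainTheorem8 {F : Type*} [Field F] [Fintype F] (q : ℕ) (hq : Fintype.card F = q)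
    (hq4 : 4 ≤ q) (G : Subgroup (Equiv.Perm (Fin (q ^ 2 - 1))))
    (V : Fin (q - 1) → Type*) [∀ i, AddCommGroup (V i)] [∀ i, Module ℂ (V i)]
    (Φ : ∀ i, Representation ℂ G (V i))
    (decomp : Nonempty (Representation.Equiv ((permRep (Fin (q ^ 2 - 1))).comp G.subtype)
      ((Representation.directSum Φ).prod (Representation.trivial ℂ G ℂ))))
    (irr : ∀ i, (Φ i).IsIrreducible)
    (deg : ∀ i, Module.finrank ℂ (V i) = if (i : ℕ) = 0 then q else q + 1)
    (inequiv : ∀ i j, i ≠ j → IsEmpty ((Φ i).Equiv (Φ j)))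
    (first : ImageIsPGLOnLines F (Φ ⟨0, by omega⟩))
    (traces : ∀ g : G, ∃ k : ℕ,
      LinearMap.trace ℂ _ (permRep (Fin (q ^ 2 - 1)) (g : Equiv.Perm (Fin (q ^ 2 - 1)))) + 1
        = (q : ℂ) ^ k) :
    ∃ (e : G ≃* GL (Fin 2) F) (x : Fin (q ^ 2 - 1) ≃ {v : Fin 2 → F // v ≠ 0}),
      ∀ (g : G) (a : Fin (q ^ 2 - 1)),
        (x ((g : Equiv.Perm (Fin (q ^ 2 - 1))) a) : Fin 2 → F)
          = Matrix.mulVec (e g : Matrix (Fin 2) (Fin 2) F) (x a : Fin 2 → F) := by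
  classical
  have _ : Fintype G := Fintype.ofFinite G
  obtain ⟨decomp⟩ := decomp
  obtain ⟨ι, -, hrange, ⟨first⟩⟩ := first
  have hF : Nat.card F = q := by rw [Nat.card_eq_fintype_card, hq]
  let toImage : G →* imageGroup (Φ ⟨0, by omega⟩) :=
    (MonoidHom.toHomUnits (Φ ⟨0, by omega⟩)).rangeRestrict
  let ψ : G →* Equiv.Perm (ℙ F (Fin 2 → F)) := ι.comp toImage
  have hψ : ψ.range = (linePerm F).range := by
    have htop : toImage.range = ⊤ :=
      MonoidHom.range_eq_top.2 (MonoidHom.rangeRestrict_surjective _)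
    rw [← pglOnLines_eq, ← hrange, MonoidHom.range_comp, htop, ← MonoidHom.range_eq_map]
  -- Pulling the tautological representation of the image back to `G` recovers the representation
  -- itself.
  have first' : (Φ ⟨0, by omega⟩).Equiv
      (MonoidHom.comp (deletedPermRep (ℙ F (Fin 2 → F))) ψ) :=
    .mk first.toLinearEquiv fun g => LinearMap.ext fun v => by
      exact (first.toIntertwiningMap.isIntertwining _ _ (toImage g) v :)
  have _ : Fintype (ℙ F (Fin 2 → F)) := Fintype.ofFinite _
  obtain ⟨h1, h0, h2⟩ := sum_card_fixed_of_decomposition G.subtype ψ V Φ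
    (fun i => by rw [deg]; split_ifs <;> omega) decomp inequiv _ first'
  have hfix : ∀ g : G, g ≠ 1 → Nat.card {x : Fin (q ^ 2 - 1) // g • x = x} = 0 ∨
      Nat.card {x : Fin (q ^ 2 - 1) // g • x = x} = q - 1 := by
    intro g hg
    obtain ⟨k, hk⟩ := traces g
    rw [trace_permRep] at hk
    have hk : Nat.card {x : Fin (q ^ 2 - 1) // g • x = x} + 1 = q ^ k := by exact_mod_cast hk
    have hlt : Nat.card {x : Fin (q ^ 2 - 1) // g • x = x} < q ^ 2 - 1 := by
      obtain ⟨x, hx⟩ : ∃ x, g • x ≠ x := by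
        by_contra! hall
        exact hg (Subtype.ext (Equiv.ext hall))
      have := Fintype.card_subtype_lt (p := fun x => g • x = x) hx
      rwa [Fintype.card_fin, ← Nat.card_eq_fintype_card] at this
    -- By faithfulness a nontrivial `g` moves some point, so q^k - 1 < q² - 1.
    have hk2 : k < 2 := by
      by_contra! h
      have := Nat.pow_le_pow_right (show 0 < q by omega) h
      omega
    interval_cases k
    · left
      simpa using hk
    · right
      rw [pow_one] at hk
      omega
  have htr : MulAction.IsPretransitive G (Fin (q ^ 2 - 1)) :=
    isPretransitive_of_sum_card_fixed h1
  obtain ⟨S⟩ := exists_planeAction ψ hψ (X := Fin (q ^ 2 - 1)) (by rw [Nat.card_fin, hF])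
    (by rwa [hF]) (by
      rw [hF]
      refine h0.trans ?_
      rw [Nat.sub_add_cancel (by omega)]) h1 h2
  obtain ⟨R⟩ := S.exists_frame
  exact R.exists_mulEquiv
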